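/- Let $n\ge 1$ and let $\Omega\subset\mathbb R^n$ be a bounded domain (nonempty, open, connected) with Lipschitz boundary. For $\delta>0$ put $\Omega^\delta=\Omega\cap(\delta\mathbb Z)^n$. Two points of a lattice $(\delta\mathbb Z)^m$ are neighbours if they differ by $\pm\delta e_j$ for some $j$; $\partial\Omega^\delta$ is the set of points of $(\delta\mathbb Z)^n\setminus\Omega^\delta$ having a neighbour in $\Omega^\delta$, and $\overline\Omega^\delta=\Omega^\delta\cup\partial\Omega^\delta$. The $\delta$-discrete Laplacian on $(\delta\mathbb Z)^m$ is $\Delta_\delta u(x)=\delta^{-2}\bigl(\sum_{j=1}^m(u(x+\delta e_j)+u(x-\delta e_j))-2m\,u(x)\bigr)$, and $u$ is $\delta$-discrete harmonic on a set of lattice points if $\Delta_\delta u=0$ at each of them. Let $\lambda_1^\delta>0$ be the smallest eigenvalue of the problem $-\Delta_\delta g=\lambda g$ in $\Omega^\delta$, $g=0$ on $\partial\Omega^\delta$, and let $a_1^\delta>0$ be the positive solution of $\cosh(\delta a_1^\delta)=1+\tfrac12\delta^2\lambda_1^\delta$. Only those $\delta>0$ are considered for which $\Omega^\delta$ is nonempty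 and connected as a set of lattice points (any two of its points are joined by a chain of successive neighbours in it). Points of $(\delta\mathbb Z)^{n+1}$ are written $(x',x_{n+1})$ with $x'\in(\delta\mathbb Z)^n$. (i) There is a constant $C_\Omega>0$, depending only on $\Omega$, such that the following holds for every such $\delta$ and every $N>0$ with $N\in\delta\mathbb Z$. Let $h$ be a real function on $\overline\Omega^\delta\times([-N,N]\cap\delta\mathbb Z)$ that is $\delta$-discrete harmonic on $\Omega^\delta\times((-N,N)\cap\delta\mathbb Z)$, equals $f$ on $\partial\Omega^\delta\times([-N,N]\cap\delta\mathbb Z)$, and satisfies $|h(x',\pm N)|\le M_N$ for all $x'\in\Omega^\delta$. Then $$\max_{x'\in\overline\Omega^\delta}|h(x',0)|\le \max|f|+C_\Omega\,(M_N+\max|f|)\exp(-a_1^\delta N),$$ where $\max|f|$ is taken over $\partial\Omega^\delta\times([-N,N]\cap\delta\mathbb Z)$. (ii) For every such $\delta$: if $h$ is a real function on $\overline\Omega^\delta\times\delta\mathbb Z$ that is $\delta$-discrete harmonic on $\Omega^\delta\times\delta\mathbb Z$, if $|h(x',x_{n+1})|=o(\exp(a_1^\delta|x_{n+1}|))$ as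 $|x_{n+1}|\to\infty$, $x'\in\Omega^\delta$, and if $|h|\le B$ on $\partial\Omega^\delta\times\delta\mathbb Z$ for a constant $B$, then $|h|\le B$ on $\overline\Omega^\delta\times\delta\mathbb Z$. -/

import Mathlib

open scoped NNReal Asymptotics RealInnerProductSpace

/-- `Ω` has Lipschitz boundary: near each of its boundary points, in suitable orthonormal
coordinates, `Ω` is the set of points lying strictly above the graph of a Lipschitz function.
Here `ν` is the vertical direction, and `y - ⟪ν, y⟫ • ν` is the horizontal component of `y`. -/
def HasLipschitzBoundary {n : ℕ} (Ω : Set (EuclideanSpace ℝ (Fin n))) : Prop :=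
  ∀ p ∈ frontier Ω, ∃ ν : EuclideanSpace ℝ (Fin n), ‖ν‖ = 1 ∧
    ∃ (K : ℝ≥0) (φ : EuclideanSpace ℝ (Fin n) → ℝ), LipschitzWith K φ ∧
      ∃ r > 0, ∀ y ∈ Metric.ball p r, (y ∈ Ω ↔ φ (y - ⟪ν, y⟫ • ν) < ⟪ν, y⟫)

/-! Throughout, the point `δ x` of the lattice `(δℤ)ᵐ` is represented by its vector
`x : Fin m → ℤ` of integer coordinates. A function on a subset of the lattice is represented by
a total function; only its values on that subset are ever used. -/

/-- `x` and `y` are neighbouring points of the lattice. -/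
def LatticeNeighbor {m : ℕ} (x y : Fin m → ℤ) : Prop :=
  ∃ j : Fin m, y = x + Pi.single j 1 ∨ y = x - Pi.single j 1

/-- The `δ`-discrete Laplacian on `(δℤ)ᵐ`. -/
noncomputable def discreteLaplacian {m : ℕ} (δ : ℝ) (u : (Fin m → ℤ) → ℝ) (x : Fin m → ℤ) : ℝ :=
  (δ ^ 2)⁻¹ * (∑ j : Fin m, (u (x + Pi.single j 1) + u (x - Pi.single j 1)) - 2 * m * u x)

/-- `u` is `δ`-discrete harmonic at every point of `D`. -/
def DiscreteHarmonicOn {m : ℕ} (δ : ℝ) (u : (Fin m → ℤ) → ℝ) (D : Set (Fin m → ℤ)) : Prop :=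
  ∀ x ∈ D, discreteLaplacian δ u x = 0

/-- A discrete domain: a nonempty set of lattice points in which any two points are joined by a
chain of successively neighbouring points of the set. -/
def IsDiscreteDomain {m : ℕ} (D : Set (Fin m → ℤ)) : Prop :=
  D.Nonempty ∧ ∀ x ∈ D, ∀ y ∈ D,
    Relation.ReflTransGen (fun a b => b ∈ D ∧ LatticeNeighbor a b) x y

/-- The discrete boundary `∂D`: lattice points outside `D` with a neighbour in `D`. -/
def discreteBoundary {m : ℕ} (D : Set (Fin m → ℤ)) : Set (Fin m → ℤ) :=
  {x | x ∉ D ∧ ∃ y ∈ D, LatticeNeighbor x y}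

/-- The discrete closure `D ∪ ∂D`. -/
def discreteClosure {m : ℕ} (D : Set (Fin m → ℤ)) : Set (Fin m → ℤ) :=
  D ∪ discreteBoundary D

/-- The discretization `Ω ∩ (δℤ)ⁿ` of `Ω`. -/
def meshPoints {n : ℕ} (δ : ℝ) (Ω : Set (EuclideanSpace ℝ (Fin n))) : Set (Fin n → ℤ) :=
  {x | WithLp.toLp 2 (fun i => δ * (x i : ℝ)) ∈ Ω}

/-- `μ` is an eigenvalue of `-Δ f = μ f` in `D`, `f = 0` on `∂D`. -/
def IsDirichletEigenvalue {m : ℕ} (δ : ℝ) (D : Set (Fin m → ℤ)) (μ : ℝ) : Prop :=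
  ∃ f : (Fin m → ℤ) → ℝ, (∃ x ∈ D, f x ≠ 0) ∧ (∀ x ∈ discreteBoundary D, f x = 0) ∧
    ∀ x ∈ D, -discreteLaplacian δ f x = μ * f x

/-- The first (smallest) eigenvalue of the discrete Dirichlet problem in `D`. -/
noncomputable def firstDirichletEigenvalue {m : ℕ} (δ : ℝ) (D : Set (Fin m → ℤ)) : ℝ :=
  sInf {μ | IsDirichletEigenvalue δ D μ}

/-- The positive solution `a` of `cosh (δ a) = 1 + δ² λ₁ / 2`, where `λ₁` is the first
eigenvalue of the discrete Dirichlet problem in `D`. -/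
noncomputable def growthExponent {m : ℕ} (δ : ℝ) (D : Set (Fin m → ℤ)) : ℝ :=
  δ⁻¹ * Real.arcosh (1 + δ ^ 2 * firstDirichletEigenvalue δ D / 2)

/-- The height `x_{n+1}` of the lattice point with integer coordinates `x`. -/
def latticeHeight {n : ℕ} (δ : ℝ) (x : Fin (n + 1) → ℤ) : ℝ :=
  δ * (x (Fin.last n) : ℝ)

/-- The part `E × (δℤ)` of the lattice `(δℤ)ⁿ⁺¹`. -/
def latticeCylinder {n : ℕ} (E : Set (Fin n → ℤ)) : Set (Fin (n + 1) → ℤ) :=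
  {x | Fin.init x ∈ E}

/-- The part `E × (S ∩ δℤ)` of the lattice `(δℤ)ⁿ⁺¹`. -/
def latticeSlab {n : ℕ} (δ : ℝ) (E : Set (Fin n → ℤ)) (S : Set ℝ) : Set (Fin (n + 1) → ℤ) :=
  {x | Fin.init x ∈ E ∧ latticeHeight δ x ∈ S}

/-!
Let `B` bound `|h|` on the lateral boundary. The excess of `|h|` over `B`, extended by zero, is a
nonnegative subsolution vanishing off the cylinder over `D = Ω^δ`. By subharmonicity, Cauchy–Schwarz
and the variational characterization of `λ₁`, the `ℓ²` norms `m k` of its horizontal layers satisfy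
`m (k + 1) + m (k - 1) ≥ 2 cosh (δ a₁) m k`, so they lie below the multiple of `cosh (δ a₁ k)` that
dominates them at two symmetric heights. Letting these heights tend to infinity gives (ii).

For (i) the `ℓ²` bound must become a pointwise one with a constant independent of `δ`. The slab of
heights between `-r` and `r` over the torus `(ℤ / 2r)ⁿ` has an explicit Poisson kernel, which is
at most `C r⁻ⁿ` at height `0`; by the maximum principle, a subsolution at height `0` is therefore
at most `C r⁻ⁿ` times the sum of its two layers at heights `±r`. At the physical scale `r ≈ 1 / δ`,
the number of points of `Ω^δ` is `O(rⁿ)` because `Ω` is bounded, and `δ a₁ r` is bounded because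
`Ω` contains a fixed cube, whose first eigenvalue dominates `λ₁`.
-/

section LatticeLaplacian

variable {n : ℕ}

theorem LatticeNeighbor.symm {x y : Fin n → ℤ} : LatticeNeighbor x y → LatticeNeighbor y x
  | ⟨j, .inl h⟩ => ⟨j, .inr (eq_sub_of_add_eq h.symm)⟩
  | ⟨j, .inr h⟩ => ⟨j, .inl (eq_add_of_sub_eq h.symm)⟩

/-- The Laplacian of the lattice `ℤⁿ` with unit mesh, as a linear map on functions. -/
def latticeLaplacian : ((Fin n → ℤ) → ℝ) →ₗ[ℝ] (Fin n → ℤ) → ℝ where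
  toFun v x := ∑ j, (v (x + Pi.single j 1) + v (x - Pi.single j 1) - 2 * v x)
  map_add' v w := by
    ext x
    simp only [Pi.add_apply, ← Finset.sum_add_distrib]
    exact Finset.sum_congr rfl fun j _ => by ring
  map_smul' c v := by
    ext x
    simp only [Pi.smul_apply, smul_eq_mul, RingHom.id_apply, Finset.mul_sum]
    exact Finset.sum_congr rfl fun j _ => by ring

theorem latticeLaplacian_apply (v : (Fin n → ℤ) → ℝ) (x : Fin n → ℤ) :
    latticeLaplacian v x = ∑ j, (v (x + Pi.single j 1) + v (x - Pi.single j 1) - 2 * v x) :=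
  rfl

theorem discreteLaplacian_eq (δ : ℝ) (v : (Fin n → ℤ) → ℝ) (x : Fin n → ℤ) :
    discreteLaplacian δ v x = (δ ^ 2)⁻¹ * latticeLaplacian v x := by
  rw [discreteLaplacian, latticeLaplacian_apply, Finset.sum_sub_distrib, Finset.sum_const,
    Finset.card_univ, Fintype.card_fin, nsmul_eq_mul]
  ring

theorem latticeLaplacian_le_of_touches {v w : (Fin n → ℤ) → ℝ} {x : Fin n → ℤ}
    (hx : v x = w x) (h : ∀ y, LatticeNeighbor x y → v y ≤ w y) :
    latticeLaplacian v x ≤ latticeLaplacian w x := by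
  rw [latticeLaplacian_apply, latticeLaplacian_apply, hx]
  gcongr with j
  · exact h _ ⟨j, .inl rfl⟩
  · exact h _ ⟨j, .inr rfl⟩

theorem latticeLaplacian_congr {v w : (Fin n → ℤ) → ℝ} {x : Fin n → ℤ}
    (hx : v x = w x) (h : ∀ y, LatticeNeighbor x y → v y = w y) :
    latticeLaplacian v x = latticeLaplacian w x :=
  le_antisymm (latticeLaplacian_le_of_touches hx fun y hy => (h y hy).le)
    (latticeLaplacian_le_of_touches hx.symm fun y hy => (h y hy).ge)

theorem latticeLaplacian_const (c : ℝ) (x : Fin n → ℤ) :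
    latticeLaplacian (fun _ => c) x = 0 := by
  rw [latticeLaplacian_apply]
  exact Finset.sum_eq_zero fun j _ => by ring

theorem latticeLaplacian_comp_sub_right (v : (Fin n → ℤ) → ℝ) (x y : Fin n → ℤ) :
    latticeLaplacian (fun z => v (z - y)) x = latticeLaplacian v (x - y) := by
  simp only [latticeLaplacian_apply, add_sub_right_comm x, sub_right_comm x]

theorem latticeLaplacian_prod (w : Fin n → ℤ → ℝ) (x : Fin n → ℤ) :
    latticeLaplacian (fun y => ∏ j, w j (y j)) x =
      ∑ j, (w j (x j + 1) + w j (x j - 1) - 2 * w j (x j)) *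
        ∏ i ∈ Finset.univ.erase j, w i (x i) := by
  have prod_update (j : Fin n) (y : Fin n → ℤ) (hy : ∀ i ≠ j, y i = x i) :
      ∏ i, w i (y i) = w j (y j) * ∏ i ∈ Finset.univ.erase j, w i (x i) := by
    rw [← Finset.mul_prod_erase _ _ (Finset.mem_univ j)]
    congr 1
    exact Finset.prod_congr rfl fun i hi => by rw [hy i (Finset.ne_of_mem_erase hi)]
  rw [latticeLaplacian_apply]
  refine Finset.sum_congr rfl fun j _ => ?_
  rw [prod_update j x fun _ _ => rfl,
    prod_update j (x + Pi.single j 1) fun i hi => by simp [hi],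
    prod_update j (x - Pi.single j 1) fun i hi => by simp [hi]]
  simp only [Pi.add_apply, Pi.sub_apply, Pi.single_eq_same]
  ring

/-- The unit-mesh Laplacian of `ℤⁿ⁺¹`, acting on functions that are given as families
`U : ℤ → (Fin n → ℤ) → ℝ` of horizontal layers indexed by the height. -/
def layerLaplacian : (ℤ → (Fin n → ℤ) → ℝ) →ₗ[ℝ] ℤ → (Fin n → ℤ) → ℝ where
  toFun U k x := latticeLaplacian (U k) x + (U (k + 1) x + U (k - 1) x - 2 * U k x)
  map_add' U V := by
    ext k x
    simp only [Pi.add_apply, map_add]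
    ring
  map_smul' c U := by
    ext k x
    simp only [Pi.smul_apply, map_smul, smul_eq_mul, RingHom.id_apply]
    ring

theorem layerLaplacian_apply (U : ℤ → (Fin n → ℤ) → ℝ) (k : ℤ) (x : Fin n → ℤ) :
    layerLaplacian U k x =
      latticeLaplacian (U k) x + (U (k + 1) x + U (k - 1) x - 2 * U k x) :=
  rfl

theorem layerLaplacian_le_of_touches {U V : ℤ → (Fin n → ℤ) → ℝ} {k : ℤ} {x : Fin n → ℤ}
    (hx : U k x = V k x) (h : ∀ y, LatticeNeighbor x y → U k y ≤ V k y)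
    (hup : U (k + 1) x ≤ V (k + 1) x) (hdown : U (k - 1) x ≤ V (k - 1) x) :
    layerLaplacian U k x ≤ layerLaplacian V k x := by
  rw [layerLaplacian_apply, layerLaplacian_apply, hx]
  have := latticeLaplacian_le_of_touches hx h
  gcongr

theorem layerLaplacian_const (c : ℝ) (k : ℤ) (x : Fin n → ℤ) :
    layerLaplacian (fun _ _ => c) k x = 0 := by
  rw [layerLaplacian_apply, latticeLaplacian_const]
  ring

theorem layerLaplacian_comp_sub_right (U : ℤ → (Fin n → ℤ) → ℝ) (k : ℤ) (x y : Fin n → ℤ) :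
    layerLaplacian (fun l z => U l (z - y)) k x = layerLaplacian U k (x - y) := by
  rw [layerLaplacian_apply, layerLaplacian_apply, latticeLaplacian_comp_sub_right]

end LatticeLaplacian

section MaximumPrinciple

variable {n L : ℕ}

theorem nonpos_of_midpoint_convex_of_pos {m : ℤ → ℝ}
    (hm : ∀ k : ℤ, |k| < L → 0 < m k → 2 * m k ≤ m (k + 1) + m (k - 1))
    (hcap : ∀ k : ℤ, |k| = L → m k ≤ 0) {k : ℤ} (hk : |k| ≤ L) : m k ≤ 0 := by
  -- A maximum point that lies highest is strictly larger than the value just above it.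
  obtain ⟨k₀, hk₀, hmax⟩ := (Finset.Icc (-L : ℤ) L).exists_max_image
    (fun k => toLex (m k, k)) ⟨0, by simp⟩
  simp only [Finset.mem_Icc, ← abs_le, Prod.Lex.toLex_le_toLex] at hk₀ hmax
  by_contra! hpos
  have hpos₀ : 0 < m k₀ := hpos.trans_le (by rcases hmax k hk with h | h <;> linarith)
  have hk₀' : |k₀| < L := hk₀.lt_of_ne fun h => hpos₀.not_ge (hcap k₀ h)
  rw [abs_lt] at hk₀'
  have hup : m (k₀ + 1) < m k₀ := by
    rcases hmax (k₀ + 1) (abs_le.2 ⟨by lia, by lia⟩) with h | h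
    · exact h
    · lia
  have hdown : m (k₀ - 1) ≤ m k₀ := by
    rcases hmax (k₀ - 1) (abs_le.2 ⟨by lia, by lia⟩) with h | h <;> linarith
  linarith [hm k₀ (abs_lt.2 hk₀') hpos₀]

theorem layers_nonpos_of_subharmonic_of_pos {W : ℤ → (Fin n → ℤ) → ℝ}
    (hmax : ∀ k : ℤ, |k| ≤ L → ∃ y, ∀ x, 0 < W k x → W k x ≤ W k y)
    (hsub : ∀ k : ℤ, |k| < L → ∀ x, 0 < W k x → 0 ≤ layerLaplacian W k x)
    (hcap : ∀ k : ℤ, |k| = L → ∀ x, W k x ≤ 0) {k : ℤ} (hk : |k| ≤ L) (x : Fin n → ℤ) :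
    W k x ≤ 0 := by
  choose! y hy using hmax
  have le_layerMax (l : ℤ) (hl : |l| ≤ L) (z : Fin n → ℤ) : W l z ≤ max (W l (y l)) 0 := by
    by_cases hz : 0 < W l z
    · exact (hy l hl z hz).trans (le_max_left _ _)
    · exact (not_lt.1 hz).trans (le_max_right _ _)
  refine (le_layerMax k hk x).trans
    (nonpos_of_midpoint_convex_of_pos (m := fun l => max (W l (y l)) 0) ?_ ?_ hk)
  · intro l hl hpos
    have hpos' : 0 < W l (y l) := by simpa using hpos
    have hconcave : latticeLaplacian (W l) (y l) ≤ 0 :=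
      (latticeLaplacian_le_of_touches (w := fun _ => W l (y l)) rfl fun z _ =>
        (le_layerMax l hl.le z).trans_eq (max_eq_left hpos'.le)).trans_eq
        (latticeLaplacian_const _ _)
    have hsub' := hsub l hl _ hpos'
    rw [layerLaplacian_apply] at hsub'
    have hup := le_layerMax (l + 1) (by rw [abs_lt] at hl; rw [abs_le]; lia) (y l)
    have hdown := le_layerMax (l - 1) (by rw [abs_lt] at hl; rw [abs_le]; lia) (y l)
    rw [max_eq_left hpos'.le]
    linarith
  · exact fun l hl => max_le (hcap l hl _) le_rfl

/-- `U`, given by its horizontal layers, is nonnegative, vanishes off the cylinder over `D`, and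
is subharmonic at the points of that cylinder at heights strictly between `-L` and `L`. -/
structure SlabSubsolution (D : Finset (Fin n → ℤ)) (L : ℕ) (U : ℤ → (Fin n → ℤ) → ℝ) : Prop where
  nonneg : ∀ k x, 0 ≤ U k x
  eq_zero : ∀ k, ∀ x ∉ D, U k x = 0
  subharmonic : ∀ k : ℤ, |k| < L → ∀ x ∈ D, 0 ≤ layerLaplacian U k x

namespace SlabSubsolution

variable {D : Finset (Fin n → ℤ)} {U : ℤ → (Fin n → ℤ) → ℝ}

theorem mono {r : ℕ} (hU : SlabSubsolution D L U) (h : r ≤ L) : SlabSubsolution D r U :=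
  ⟨hU.nonneg, hU.eq_zero, fun k hk => hU.subharmonic k (hk.trans_le (by exact_mod_cast h))⟩

theorem le_of_superharmonic (hU : SlabSubsolution D L U) {V : ℤ → (Fin n → ℤ) → ℝ}
    (hVnonneg : ∀ k : ℤ, |k| ≤ L → ∀ x, 0 ≤ V k x)
    (hV : ∀ k x, layerLaplacian V k x ≤ 0)
    (hcap : ∀ k : ℤ, |k| = L → ∀ x ∈ D, U k x ≤ V k x) {k : ℤ} (hk : |k| ≤ L) (x : Fin n → ℤ) :
    U k x ≤ V k x := by
  have mem_of_pos {l : ℤ} (hl : |l| ≤ L) {z : Fin n → ℤ} (hz : 0 < (U - V) l z) : z ∈ D := by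
    by_contra h
    simp only [Pi.sub_apply, hU.eq_zero l z h] at hz
    linarith [hVnonneg l hl z]
  refine sub_nonpos.1 (layers_nonpos_of_subharmonic_of_pos (W := U - V) ?_ ?_ ?_ hk x)
  · intro l hl
    rcases D.eq_empty_or_nonempty with rfl | hD
    · exact ⟨0, fun z hz => absurd (mem_of_pos hl hz) (Finset.notMem_empty z)⟩
    · obtain ⟨y, -, hy⟩ := D.exists_max_image ((U - V) l) hD
      exact ⟨y, fun z hz => hy z (mem_of_pos hl hz)⟩
  · intro l hl z hz
    simpa using (hV l z).trans (hU.subharmonic l hl z (mem_of_pos hl.le hz))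
  · intro l hl z
    by_contra! hz
    exact hz.not_ge (sub_nonpos.2 (hcap l hl z (mem_of_pos hl.le hz)))

theorem le_of_caps_le (hU : SlabSubsolution D L U) {M : ℝ} (hM : 0 ≤ M)
    (hcap : ∀ k : ℤ, |k| = L → ∀ x ∈ D, U k x ≤ M) {k : ℤ} (hk : |k| ≤ L) (x : Fin n → ℤ) :
    U k x ≤ M :=
  hU.le_of_superharmonic (V := fun _ _ => M) (fun _ _ _ => hM)
    (fun l z => (layerLaplacian_const M l z).le) hcap hk x

end SlabSubsolution

end MaximumPrinciple

section SlabKernel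

variable {n : ℕ}

theorem cosh_mul_add_one_add_cosh_mul_sub_one (a t : ℝ) :
    Real.cosh (a * (t + 1)) + Real.cosh (a * (t - 1)) = 2 * Real.cosh a * Real.cosh (a * t) := by
  rw [mul_add, mul_sub, mul_one, Real.cosh_add, Real.cosh_sub]
  ring

theorem cos_mul_add_one_add_cos_mul_sub_one (a t : ℝ) :
    Real.cos (a * (t + 1)) + Real.cos (a * (t - 1)) = 2 * Real.cos a * Real.cos (a * t) := by
  rw [mul_add, mul_sub, mul_one, Real.cos_add, Real.cos_sub]
  ring

/-- The rate `ρ` at which a harmonic function on `ℤⁿ × ℤ` with horizontal frequencies `θ` grows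
vertically. -/
noncomputable def verticalRate (θ : Fin n → ℝ) : ℝ :=
  Real.arcosh (1 + ∑ j, (1 - Real.cos (θ j)))

theorem one_le_one_add_sum_one_sub_cos (θ : Fin n → ℝ) :
    1 ≤ 1 + ∑ j, (1 - Real.cos (θ j)) :=
  le_add_of_nonneg_right (Finset.sum_nonneg fun _ _ => sub_nonneg.2 (Real.cos_le_one _))

theorem cosh_verticalRate (θ : Fin n → ℝ) :
    Real.cosh (verticalRate θ) = 1 + ∑ j, (1 - Real.cos (θ j)) :=
  Real.cosh_arcosh (one_le_one_add_sum_one_sub_cos θ)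

theorem verticalRate_nonneg (θ : Fin n → ℝ) : 0 ≤ verticalRate θ :=
  Real.arcosh_nonneg (one_le_one_add_sum_one_sub_cos θ)

theorem cosh_div_three_le_two_sub_cos {t : ℝ} (ht : |t| ≤ Real.pi) :
    Real.cosh (t / 3) ≤ 2 - Real.cos t := by
  have hpi : Real.pi ^ 2 ≤ 18 := by nlinarith [Real.pi_pos, Real.pi_lt_d2]
  have ht2 : t ^ 2 ≤ Real.pi ^ 2 := sq_le_sq' (abs_le.1 ht).1 (abs_le.1 ht).2
  have hsmall : |t ^ 2 / 18| ≤ 1 := by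
    rw [abs_of_nonneg (by positivity)]
    linarith
  calc Real.cosh (t / 3) ≤ Real.exp ((t / 3) ^ 2 / 2) := Real.cosh_le_exp_half_sq _
    _ = Real.exp (t ^ 2 / 18) := by ring_nf
    _ ≤ 1 + 2 * |t ^ 2 / 18| := by
      linarith [le_abs_self (Real.exp (t ^ 2 / 18) - 1), Real.abs_exp_sub_one_le hsmall]
    _ = 1 + 2 / 18 * t ^ 2 := by
      rw [abs_of_nonneg (by positivity)]
      ring
    _ ≤ 1 + 2 / Real.pi ^ 2 * t ^ 2 := by gcongr
    _ ≤ 2 - Real.cos t := by linarith [Real.cos_le_one_sub_mul_cos_sq ht]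

theorem abs_div_three_le_verticalRate {θ : Fin n → ℝ} {j : Fin n} (hj : |θ j| ≤ Real.pi) :
    |θ j| / 3 ≤ verticalRate θ := by
  have hcosh : Real.cosh (θ j / 3) ≤ Real.cosh (verticalRate θ) := by
    have := Finset.single_le_sum (f := fun i => 1 - Real.cos (θ i))
      (fun i _ => sub_nonneg.2 (Real.cos_le_one _)) (Finset.mem_univ j)
    rw [cosh_verticalRate]
    linarith [cosh_div_three_le_two_sub_cos hj]
  rwa [Real.cosh_le_cosh, abs_of_nonneg (verticalRate_nonneg θ), abs_div,
    abs_of_pos (three_pos : (0 : ℝ) < 3)] at hcosh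

/-- The harmonic function on `ℤⁿ × ℤ` with horizontal frequencies `θ` that is even in every
variable. -/
noncomputable def separatedWave (θ : Fin n → ℝ) (k : ℤ) (x : Fin n → ℤ) : ℝ :=
  Real.cosh (verticalRate θ * k) * ∏ j, Real.cos (θ j * x j)

theorem latticeLaplacian_prod_cos (θ : Fin n → ℝ) (x : Fin n → ℤ) :
    latticeLaplacian (fun y => ∏ j, Real.cos (θ j * y j)) x =
      -2 * (∑ j, (1 - Real.cos (θ j))) * ∏ j, Real.cos (θ j * x j) := by
  rw [latticeLaplacian_prod (fun j t => Real.cos (θ j * t)), Finset.mul_sum, Finset.sum_mul]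
  refine Finset.sum_congr rfl fun j _ => ?_
  rw [← Finset.mul_prod_erase _ _ (Finset.mem_univ j)]
  push_cast
  rw [cos_mul_add_one_add_cos_mul_sub_one]
  ring

theorem layerLaplacian_separatedWave (θ : Fin n → ℝ) : layerLaplacian (separatedWave θ) = 0 := by
  ext k x
  have horizontal : latticeLaplacian (separatedWave θ k) x =
      Real.cosh (verticalRate θ * k) *
        (-2 * (∑ j, (1 - Real.cos (θ j))) * ∏ j, Real.cos (θ j * x j)) := by
    rw [← latticeLaplacian_prod_cos, ← smul_eq_mul, ← Pi.smul_apply, ← map_smul]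
    rfl
  have vertical := cosh_mul_add_one_add_cosh_mul_sub_one (verticalRate θ) k
  rw [cosh_verticalRate] at vertical
  rw [layerLaplacian_apply, horizontal]
  simp only [separatedWave, Int.cast_add, Int.cast_sub, Int.cast_one, Pi.zero_apply]
  linear_combination (∏ j, Real.cos (θ j * x j)) * vertical

/-- The frequencies of the characters of the torus `(ℤ / 2r)ⁿ`, indexed by the vectors `m` with
`-r ≤ m j < r`. -/
noncomputable def torusFrequency (r : ℕ) (m : Fin n → ℤ) (j : Fin n) : ℝ :=
  Real.pi * m j / r

theorem sum_mul_inv_le_verticalRate_torusFrequency {r : ℕ} {m : Fin n → ℤ}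
    (hm : ∀ j, |m j| ≤ r) :
    ∑ j, ((n : ℝ) + 1)⁻¹ * |(m j : ℝ)| ≤ verticalRate (torusFrequency r m) * r := by
  rcases r.eq_zero_or_pos with rfl | hr
  · have : m = 0 := funext fun j => by simpa using hm j
    simp [this]
  have hr' : (0 : ℝ) < r := Nat.cast_pos.2 hr
  have coordinate (j : Fin n) : |(m j : ℝ)| ≤ verticalRate (torusFrequency r m) * r := by
    have habs : |torusFrequency r m j| = Real.pi * |(m j : ℝ)| / r := by
      rw [torusFrequency, abs_div, abs_mul, abs_of_pos Real.pi_pos, abs_of_pos hr']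
    have hmj : |(m j : ℝ)| ≤ r := by exact_mod_cast hm j
    have hrate := abs_div_three_le_verticalRate (θ := torusFrequency r m) (j := j) <| by
      rw [habs, div_le_iff₀ hr']
      gcongr
    rw [habs, div_div, div_le_iff₀ (by positivity)] at hrate
    nlinarith [Real.pi_gt_three, abs_nonneg (m j : ℝ)]
  rw [← Finset.mul_sum, inv_mul_le_iff₀ (by positivity)]
  calc ∑ j, |(m j : ℝ)| ≤ ∑ _j : Fin n, verticalRate (torusFrequency r m) * r :=
        Finset.sum_le_sum fun j _ => coordinate j
    _ = n * (verticalRate (torusFrequency r m) * r) := by simp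
    _ ≤ (n + 1) * (verticalRate (torusFrequency r m) * r) := by
      have := mul_nonneg (verticalRate_nonneg (torusFrequency r m)) hr'.le
      linarith

/-- The Poisson kernel, with pole over `0`, of the slab of heights between `-r` and `r` over the
torus `(ℤ / 2r)ⁿ`: harmonic, and equal on both caps to the indicator of the multiples of `2r`. -/
noncomputable def slabKernel (r : ℕ) : ℤ → (Fin n → ℤ) → ℝ :=
  ((2 * r : ℝ) ^ n)⁻¹ • ∑ m ∈ Fintype.piFinset fun _ : Fin n => Finset.Ico (-r : ℤ) r,
    (Real.cosh (verticalRate (torusFrequency r m) * r))⁻¹ • separatedWave (torusFrequency r m)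

theorem slabKernel_apply (r : ℕ) (k : ℤ) (x : Fin n → ℤ) :
    slabKernel r k x =
      ((2 * r : ℝ) ^ n)⁻¹ * ∑ m ∈ Fintype.piFinset fun _ : Fin n => Finset.Ico (-r : ℤ) r,
        (Real.cosh (verticalRate (torusFrequency r m) * r))⁻¹ *
          separatedWave (torusFrequency r m) k x := by
  simp only [slabKernel, Pi.smul_apply, Finset.sum_apply, smul_eq_mul]

theorem layerLaplacian_slabKernel (r : ℕ) :
    layerLaplacian (slabKernel r : ℤ → (Fin n → ℤ) → ℝ) = 0 := by
  simp [slabKernel, layerLaplacian_separatedWave]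

theorem sum_cos_pi_mul_div_nonneg (r : ℕ) (a : ℤ) :
    0 ≤ ∑ m ∈ Finset.Ico (-r : ℤ) r, Real.cos (Real.pi * m / r * a) := by
  rcases r.eq_zero_or_pos with rfl | hr
  · simp
  set φ : ℝ := Real.pi * a / r with hφ
  have hφr : φ * r = a * Real.pi := by rw [hφ]; field_simp
  have hterm (m : ℤ) : Real.pi * m / r * a = φ * m := by rw [hφ]; ring
  simp only [hterm]
  by_cases hs : Real.sin (φ / 2) = 0
  · obtain ⟨l, hl⟩ := Real.sin_eq_zero_iff.1 hs
    refine Finset.sum_nonneg fun m _ => ?_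
    have : φ * m = ((l * m : ℤ) : ℝ) * (2 * Real.pi) := by
      push_cast
      linear_combination -2 * (m : ℝ) * hl
    rw [this, Real.cos_int_mul_two_pi]
    exact zero_le_one
  · have product_to_sum (m : ℤ) : -2 * Real.sin (φ / 2) * Real.cos (φ * m) =
        Real.sin (φ * m - φ / 2) - Real.sin (φ * (m + 1 : ℤ) - φ / 2) := by
      rw [show φ * ((m + 1 : ℤ) : ℝ) - φ / 2 = φ * m + φ / 2 by push_cast; ring, Real.sin_add,
        Real.sin_sub]
      ring
    have telescoped :
        -2 * Real.sin (φ / 2) * ∑ m ∈ Finset.Ico (-r : ℤ) r, Real.cos (φ * m) = 0 := by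
      simp only [Finset.mul_sum, product_to_sum]
      rw [Finset.sum_Ico_int_sub r (fun m : ℤ => Real.sin (φ * m - φ / 2))]
      push_cast
      rw [mul_neg, ← neg_add', Real.sin_neg, hφr, Real.sin_sub, Real.sin_add, Real.sin_int_mul_pi]
      ring
    exact ((mul_eq_zero.1 telescoped).resolve_left (by simpa using hs)).ge

theorem slabKernel_cap (r : ℕ) {k : ℤ} (hk : |k| = r) (x : Fin n → ℤ) :
    slabKernel r k x = ((2 * r : ℝ) ^ n)⁻¹ *
      ∏ j, ∑ m ∈ Finset.Ico (-r : ℤ) r, Real.cos (Real.pi * m / r * x j) := by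
  rw [slabKernel_apply, Finset.prod_univ_sum]
  congr 1
  refine Finset.sum_congr rfl fun m _ => ?_
  have hcosh : Real.cosh (verticalRate (torusFrequency r m) * k) =
      Real.cosh (verticalRate (torusFrequency r m) * r) := by
    rw [← Real.cosh_abs, abs_mul, abs_of_nonneg (verticalRate_nonneg _), ← Int.cast_abs, hk,
      Int.cast_natCast]
  rw [separatedWave, hcosh, inv_mul_cancel_left₀ (Real.cosh_pos _).ne']
  rfl

theorem slabKernel_cap_zero {r : ℕ} (hr : 0 < r) {k : ℤ} (hk : |k| = r) :
    slabKernel r k (0 : Fin n → ℤ) = 1 := by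
  have : (2 * r : ℝ) ^ n ≠ 0 := by positivity
  have hcard : ((2 * r : ℤ).toNat : ℝ) = 2 * r := by norm_cast
  rw [slabKernel_cap r hk]
  simp [← two_mul, hcard, inv_mul_cancel₀ this]

theorem slabKernel_emod {r : ℕ} (hr : 0 < r) (k : ℤ) (x : Fin n → ℤ) :
    slabKernel r k (fun j => x j % (2 * r : ℤ)) = slabKernel r k x := by
  have hr' : (r : ℝ) ≠ 0 := by positivity
  simp only [slabKernel_apply, separatedWave]
  congr! 5 with m - j
  have hx : (x j : ℝ) = (x j % (2 * r : ℤ) : ℤ) + 2 * r * (x j / (2 * r : ℤ) : ℤ) := by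
    exact_mod_cast (Int.emod_add_mul_ediv (x j) (2 * r)).symm
  have shift : torusFrequency r m j * x j = torusFrequency r m j * (x j % (2 * r : ℤ) : ℤ) +
      (m j * (x j / (2 * r : ℤ)) : ℤ) * (2 * Real.pi) := by
    rw [hx, torusFrequency]
    push_cast
    field_simp
  rw [shift, Real.cos_add_int_mul_two_pi]

theorem slabKernel_nonneg {r : ℕ} (hr : 0 < r) {k : ℤ} (hk : |k| ≤ r) (x : Fin n → ℤ) :
    0 ≤ slabKernel r k x := by
  refine neg_nonpos.1 (layers_nonpos_of_subharmonic_of_pos (W := -slabKernel r) ?_ ?_ ?_ hk x)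
  · intro l _
    have hr2 : (0 : ℤ) < 2 * r := by lia
    obtain ⟨y, -, hy⟩ := (Fintype.piFinset fun _ : Fin n => Finset.Ico (0 : ℤ) (2 * r))
      |>.exists_max_image ((-slabKernel r) l) ⟨0, by simp [hr]⟩
    refine ⟨y, fun z _ => ?_⟩
    have hz := hy (fun j => z j % (2 * r : ℤ)) <| by
      simp only [Fintype.mem_piFinset, Finset.mem_Ico]
      exact fun j => ⟨Int.emod_nonneg _ hr2.ne', Int.emod_lt_of_pos _ hr2⟩
    simpa only [Pi.neg_apply, slabKernel_emod hr] using hz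
  · simp [layerLaplacian_slabKernel]
  · intro l hl z
    rw [Pi.neg_apply, Pi.neg_apply, slabKernel_cap r hl, neg_nonpos]
    exact mul_nonneg (by positivity) (Finset.prod_nonneg fun j _ => sum_cos_pi_mul_div_nonneg r _)

theorem summable_exp_neg_mul_abs_int {c : ℝ} (hc : 0 < c) :
    Summable fun m : ℤ => Real.exp (-(c * |(m : ℝ)|)) := by
  have h : Summable fun m : ℕ => Real.exp (-(c * (m : ℝ))) :=
    (Real.summable_exp_nat_mul_iff.2 (neg_lt_zero.2 hc)).congr fun m => by ring_nf
  exact .of_nat_of_neg (by simpa using h) (by simpa using h)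

theorem inv_cosh_le_two_mul_exp_neg (x : ℝ) : (Real.cosh x)⁻¹ ≤ 2 * Real.exp (-x) := by
  rw [Real.exp_neg, ← div_eq_mul_inv, ← inv_div, Real.cosh_eq]
  gcongr
  exact le_add_of_nonneg_right (Real.exp_pos _).le

theorem exists_slabKernel_zero_le (n : ℕ) :
    ∃ C : ℝ, 0 < C ∧ ∀ r : ℕ, 0 < r → ∀ x : Fin n → ℤ, slabKernel r 0 x ≤ C / (r : ℝ) ^ n := by
  set c : ℝ := ((n : ℝ) + 1)⁻¹
  have hsum := summable_exp_neg_mul_abs_int (c := c) (by positivity)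
  set S : ℝ := ∑' m : ℤ, Real.exp (-(c * |(m : ℝ)|))
  have hS : 0 < S := hsum.tsum_pos (fun _ => (Real.exp_pos _).le) 0 (Real.exp_pos _)
  refine ⟨2 * (S / 2) ^ n, by positivity, fun r hr x => ?_⟩
  have term_le (m : Fin n → ℤ) (hm : ∀ j, |m j| ≤ r) :
      (Real.cosh (verticalRate (torusFrequency r m) * r))⁻¹ *
        separatedWave (torusFrequency r m) 0 x ≤ 2 * ∏ j, Real.exp (-(c * |(m j : ℝ)|)) := by
    have hwave : separatedWave (torusFrequency r m) 0 x ≤ 1 := by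
      rw [separatedWave, Int.cast_zero, mul_zero, Real.cosh_zero, one_mul]
      refine (le_abs_self _).trans ?_
      rw [Finset.abs_prod]
      exact Finset.prod_le_one (fun _ _ => abs_nonneg _) fun _ _ => Real.abs_cos_le_one _
    calc _ ≤ (Real.cosh (verticalRate (torusFrequency r m) * r))⁻¹ :=
          mul_le_of_le_one_right (inv_nonneg.2 (Real.cosh_pos _).le) hwave
      _ ≤ 2 * Real.exp (-(verticalRate (torusFrequency r m) * r)) := inv_cosh_le_two_mul_exp_neg _
      _ ≤ 2 * Real.exp (-∑ j, c * |(m j : ℝ)|) := by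
        gcongr
        exact sum_mul_inv_le_verticalRate_torusFrequency hm
      _ = 2 * ∏ j, Real.exp (-(c * |(m j : ℝ)|)) := by
        rw [← Finset.sum_neg_distrib, Real.exp_sum]
  calc slabKernel r 0 x
      ≤ ((2 * r : ℝ) ^ n)⁻¹ * ∑ m ∈ Fintype.piFinset fun _ : Fin n => Finset.Ico (-r : ℤ) r,
          2 * ∏ j, Real.exp (-(c * |(m j : ℝ)|)) := by
        rw [slabKernel_apply]
        refine mul_le_mul_of_nonneg_left (Finset.sum_le_sum fun m hm => ?_) (by positivity)
        refine term_le m fun j => abs_le.2 ?_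
        have := Finset.mem_Ico.1 (Fintype.mem_piFinset.1 hm j)
        lia
    _ = ((2 * r : ℝ) ^ n)⁻¹ * (2 * ∏ _j : Fin n, ∑ m ∈ Finset.Ico (-r : ℤ) r,
          Real.exp (-(c * |(m : ℝ)|))) := by rw [← Finset.mul_sum, Finset.prod_univ_sum]
    _ ≤ ((2 * r : ℝ) ^ n)⁻¹ * (2 * ∏ _j : Fin n, S) := by
        gcongr
        exact hsum.sum_le_tsum _ fun _ _ => (Real.exp_pos _).le
    _ = 2 * (S / 2) ^ n / r ^ n := by
        rw [Finset.prod_const, Finset.card_univ, Fintype.card_fin, div_pow, mul_pow]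
        field_simp

theorem SlabSubsolution.le_sum_slabKernel {D : Finset (Fin n → ℤ)} {r : ℕ} (hr : 0 < r)
    {U : ℤ → (Fin n → ℤ) → ℝ} (hU : SlabSubsolution D r U) {k : ℤ} (hk : |k| ≤ r)
    (x : Fin n → ℤ) :
    U k x ≤ ∑ y ∈ D, (U r y + U (-r) y) * slabKernel r k (x - y) := by
  have hcoeff (y : Fin n → ℤ) : 0 ≤ U r y + U (-r) y := add_nonneg (hU.nonneg _ _) (hU.nonneg _ _)
  refine hU.le_of_superharmonic
    (V := fun l z => ∑ y ∈ D, (U r y + U (-r) y) * slabKernel r l (z - y)) ?_ ?_ ?_ hk x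
  · exact fun l hl z =>
      Finset.sum_nonneg fun y _ => mul_nonneg (hcoeff y) (slabKernel_nonneg hr hl _)
  · intro l z
    have hV : (fun l z => ∑ y ∈ D, (U r y + U (-r) y) * slabKernel r l (z - y)) =
        ∑ y ∈ D, (U r y + U (-r) y) • fun l z => slabKernel r l (z - y) := by
      ext l z
      simp
    simp [hV, layerLaplacian_comp_sub_right, layerLaplacian_slabKernel]
  · intro l hl z hz
    calc U l z ≤ U r z + U (-r) z := by
          rcases (abs_eq (Nat.cast_nonneg r)).1 hl with rfl | rfl
          · exact le_add_of_nonneg_right (hU.nonneg _ _)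
          · exact le_add_of_nonneg_left (hU.nonneg _ _)
      _ = (U r z + U (-r) z) * slabKernel r l (z - z) := by
          rw [sub_self, slabKernel_cap_zero hr hl, mul_one]
      _ ≤ _ := Finset.single_le_sum
          (f := fun y => (U r y + U (-r) y) * slabKernel r l (z - y))
          (fun y _ => mul_nonneg (hcoeff y) (slabKernel_nonneg hr hl.le _)) hz

theorem exists_meanValue_inequality (n : ℕ) :
    ∃ C : ℝ, 0 < C ∧ ∀ (r : ℕ), 0 < r → ∀ (D : Finset (Fin n → ℤ)) (U : ℤ → (Fin n → ℤ) → ℝ),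
      SlabSubsolution D r U → ∀ x, U 0 x ≤ C / (r : ℝ) ^ n * ∑ y ∈ D, (U r y + U (-r) y) := by
  obtain ⟨C, hC, hkernel⟩ := exists_slabKernel_zero_le n
  refine ⟨C, hC, fun r hr D U hU x => ?_⟩
  rw [mul_comm, Finset.sum_mul]
  refine (hU.le_sum_slabKernel hr (by simp) x).trans (Finset.sum_le_sum fun y _ => ?_)
  exact mul_le_mul_of_nonneg_left (hkernel r hr _) (add_nonneg (hU.nonneg _ _) (hU.nonneg _ _))

end SlabKernel

section DirichletSpectrum

variable {n : ℕ} {D : Finset (Fin n → ℤ)} {κ : ℝ}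

theorem sum_mul_comp_add_right {v w : (Fin n → ℤ) → ℝ} (hv : ∀ x ∉ D, v x = 0)
    (hw : ∀ x ∉ D, w x = 0) (e : Fin n → ℤ) :
    ∑ x ∈ D, v x * w (x + e) = ∑ x ∈ D, w x * v (x - e) := by
  calc ∑ x ∈ D, v x * w (x + e) = ∑' x, v x * w (x + e) :=
        (tsum_eq_sum fun x hx => by rw [hv x hx, zero_mul]).symm
    _ = ∑' x, w x * v (x - e) := by
        rw [← (Equiv.subRight e).tsum_eq]
        exact tsum_congr fun x => by rw [Equiv.subRight_apply, sub_add_cancel, mul_comm]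
    _ = ∑ x ∈ D, w x * v (x - e) := tsum_eq_sum fun x hx => by rw [hw x hx, zero_mul]

theorem sum_mul_latticeLaplacian_comm {v w : (Fin n → ℤ) → ℝ} (hv : ∀ x ∉ D, v x = 0)
    (hw : ∀ x ∉ D, w x = 0) :
    ∑ x ∈ D, v x * latticeLaplacian w x = ∑ x ∈ D, w x * latticeLaplacian v x := by
  simp only [latticeLaplacian_apply, Finset.mul_sum]
  rw [Finset.sum_comm, Finset.sum_comm (s := D)]
  refine Finset.sum_congr rfl fun j _ => ?_
  simp only [mul_sub, mul_add, Finset.sum_sub_distrib, Finset.sum_add_distrib,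
    sum_mul_comp_add_right hv hw, ← sum_mul_comp_add_right hw hv]
  rw [add_comm]
  congr 1
  exact Finset.sum_congr rfl fun x _ => by ring

theorem sum_sq_comp_add_right_le {v : (Fin n → ℤ) → ℝ} (hv : ∀ x ∉ D, v x = 0) (e : Fin n → ℤ) :
    ∑ x ∈ D, v (x + e) ^ 2 ≤ ∑ x ∈ D, v x ^ 2 := by
  have hsq : ∀ x ∉ D, v x ^ 2 = 0 := fun x hx => by rw [hv x hx, zero_pow two_ne_zero]
  have hsum := (Equiv.addRight e).summable_iff.2 (summable_of_ne_finset_zero hsq)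
  calc ∑ x ∈ D, v (x + e) ^ 2 ≤ ∑' x, v (x + e) ^ 2 := hsum.sum_le_tsum D fun _ _ => sq_nonneg _
    _ = ∑' x, v x ^ 2 := (Equiv.addRight e).tsum_eq fun x => v x ^ 2
    _ = ∑ x ∈ D, v x ^ 2 := tsum_eq_sum hsq

theorem dirichletEnergy_nonneg {v : (Fin n → ℤ) → ℝ} (hv : ∀ x ∉ D, v x = 0) :
    0 ≤ ∑ x ∈ D, v x * -latticeLaplacian v x := by
  have direction (j : Fin n) :
      ∑ x ∈ D, v x * (v (x + Pi.single j 1) + v (x - Pi.single j 1) - 2 * v x) ≤ 0 := by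
    have hshift := sum_sq_comp_add_right_le hv (Pi.single j 1)
    have hshift' := sum_sq_comp_add_right_le hv (-Pi.single j 1)
    simp only [← sub_eq_add_neg] at hshift'
    calc ∑ x ∈ D, v x * (v (x + Pi.single j 1) + v (x - Pi.single j 1) - 2 * v x)
        ≤ ∑ x ∈ D, ((v (x + Pi.single j 1) ^ 2 + v (x - Pi.single j 1) ^ 2) / 2 - v x ^ 2) := by
          refine Finset.sum_le_sum fun x _ => ?_
          linarith [two_mul_le_add_sq (v x) (v (x + Pi.single j 1)),
            two_mul_le_add_sq (v x) (v (x - Pi.single j 1))]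
      _ ≤ 0 := by
          rw [Finset.sum_sub_distrib, ← Finset.sum_div, Finset.sum_add_distrib]
          linarith
  simp only [mul_neg, Finset.sum_neg_distrib, latticeLaplacian_apply, Finset.mul_sum]
  rw [Finset.sum_comm, neg_nonneg]
  exact Finset.sum_nonpos fun j _ => direction j

/-- The Poincaré inequality with constant `κ` for the functions on the lattice that vanish off the
finite set `D`; the largest such `κ` is the first Dirichlet eigenvalue of `D` for unit mesh. -/
def PoincareInequality (D : Finset (Fin n → ℤ)) (κ : ℝ) : Prop :=
  ∀ v : (Fin n → ℤ) → ℝ, (∀ x ∉ D, v x = 0) →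
    κ * ∑ x ∈ D, v x ^ 2 ≤ ∑ x ∈ D, v x * -latticeLaplacian v x

theorem PoincareInequality.mono {κ' : ℝ} (h : PoincareInequality D κ) (hκ : κ' ≤ κ) :
    PoincareInequality D κ' := fun v hv =>
  (mul_le_mul_of_nonneg_right hκ (Finset.sum_nonneg fun _ _ => sq_nonneg _)).trans (h v hv)

theorem PoincareInequality.le_of_supersolution (h : PoincareInequality D κ) {lam : ℝ}
    {v : (Fin n → ℤ) → ℝ} (hv : ∀ x ∉ D, v x = 0) (hnonneg : ∀ x, 0 ≤ v x)
    (hne : ∃ x ∈ D, v x ≠ 0) (hsuper : ∀ x ∈ D, -latticeLaplacian v x ≤ lam * v x) :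
    κ ≤ lam := by
  obtain ⟨x, hx, hvx⟩ := hne
  have hpos : 0 < ∑ x ∈ D, v x ^ 2 :=
    Finset.sum_pos' (fun _ _ => sq_nonneg _) ⟨x, hx, sq_pos_of_ne_zero hvx⟩
  refine le_of_mul_le_mul_right ((h v hv).trans ?_) hpos
  rw [Finset.mul_sum]
  refine Finset.sum_le_sum fun y hy => ?_
  calc v y * -latticeLaplacian v y ≤ v y * (lam * v y) :=
        mul_le_mul_of_nonneg_left (hsuper y hy) (hnonneg y)
    _ = lam * v y ^ 2 := by ring

/-- The extension by zero of a function on `D` to the whole lattice. -/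
noncomputable def zeroExtension (D : Finset (Fin n → ℤ)) :
    EuclideanSpace ℝ D →ₗ[ℝ] (Fin n → ℤ) → ℝ :=
  Function.ExtendByZero.linearMap ℝ Subtype.val ∘ₗ (WithLp.linearEquiv 2 ℝ (D → ℝ)).toLinearMap

theorem zeroExtension_apply (u : EuclideanSpace ℝ D) (x : D) : zeroExtension D u x = u x :=
  Subtype.val_injective.extend_apply _ _ x

theorem zeroExtension_of_notMem (u : EuclideanSpace ℝ D) {x : Fin n → ℤ} (hx : x ∉ D) :
    zeroExtension D u x = 0 :=
  Function.extend_apply' _ _ x fun ⟨y, hy⟩ => hx (hy ▸ y.2)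

theorem zeroExtension_restrict {v : (Fin n → ℤ) → ℝ} (hv : ∀ x ∉ D, v x = 0) :
    zeroExtension D (WithLp.toLp 2 fun x : D => v x) = v := by
  ext x
  by_cases hx : x ∈ D
  · exact zeroExtension_apply _ ⟨x, hx⟩
  · rw [zeroExtension_of_notMem _ hx, hv x hx]

/-- The operator `-Δ` with zero boundary values, on the Euclidean space of functions on `D`, where
the spectral theory of symmetric operators applies to it. -/
noncomputable def dirichletOperator (D : Finset (Fin n → ℤ)) :
    EuclideanSpace ℝ D →ₗ[ℝ] EuclideanSpace ℝ D :=
  (WithLp.linearEquiv 2 ℝ (D → ℝ)).symm.toLinearMap ∘ₗ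
    LinearMap.funLeft ℝ ℝ Subtype.val ∘ₗ (-latticeLaplacian) ∘ₗ zeroExtension D

theorem dirichletOperator_apply (u : EuclideanSpace ℝ D) (x : D) :
    dirichletOperator D u x = -latticeLaplacian (zeroExtension D u) x :=
  rfl

theorem inner_dirichletOperator (u w : EuclideanSpace ℝ D) :
    ⟪dirichletOperator D u, w⟫ =
      ∑ x ∈ D, zeroExtension D w x * -latticeLaplacian (zeroExtension D u) x := by
  rw [PiLp.inner_apply, ← Finset.sum_coe_sort D]
  exact Finset.sum_congr rfl fun x _ => by
    rw [zeroExtension_apply, ← dirichletOperator_apply, Real.inner_apply, mul_comm]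

theorem isSymmetric_dirichletOperator (D : Finset (Fin n → ℤ)) :
    (dirichletOperator D).IsSymmetric := fun u w => by
  rw [real_inner_comm _ u, inner_dirichletOperator, inner_dirichletOperator]
  simp only [mul_neg, Finset.sum_neg_distrib, neg_inj]
  exact sum_mul_latticeLaplacian_comm (fun _ hx => zeroExtension_of_notMem _ hx)
    fun _ hx => zeroExtension_of_notMem _ hx

theorem poincareInequality_iInf_rayleighQuotient (D : Finset (Fin n → ℤ)) :
    PoincareInequality D (⨅ u : {u : EuclideanSpace ℝ D // u ≠ 0},
      RCLike.re ⟪dirichletOperator D u, (u : EuclideanSpace ℝ D)⟫ /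
        ‖(u : EuclideanSpace ℝ D)‖ ^ 2) := by
  intro v hv
  set u : EuclideanSpace ℝ D := WithLp.toLp 2 fun x : D => v x
  have norm_sq : ∑ x ∈ D, v x ^ 2 = ‖u‖ ^ 2 := by
    rw [EuclideanSpace.real_norm_sq_eq, ← Finset.sum_coe_sort D]
  have energy : ∑ x ∈ D, v x * -latticeLaplacian v x = ⟪dirichletOperator D u, u⟫ := by
    rw [inner_dirichletOperator, zeroExtension_restrict hv]
  rw [norm_sq, energy]
  by_cases hu0 : u = 0
  · simp [hu0]
  rw [← le_div_iff₀ (by positivity)]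
  refine ciInf_le (ι := {u : EuclideanSpace ℝ D // u ≠ 0}) ⟨0, ?_⟩ ⟨u, hu0⟩
  rintro _ ⟨w, rfl⟩
  refine div_nonneg ?_ (sq_nonneg _)
  rw [RCLike.re_to_real, inner_dirichletOperator]
  exact dirichletEnergy_nonneg fun x hx => zeroExtension_of_notMem _ hx

theorem exists_isDirichletEigenvalue_poincareInequality {δ : ℝ} (hδ : 0 < δ) (hD : D.Nonempty) :
    ∃ μ, IsDirichletEigenvalue δ (D : Set (Fin n → ℤ)) μ ∧
      PoincareInequality D (δ ^ 2 * μ) := by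
  have : Nonempty D := hD.to_subtype
  obtain ⟨u, hu⟩ := (isSymmetric_dirichletOperator D).hasEigenvalue_iInf_of_finiteDimensional
    |>.exists_hasEigenvector
  have hpoincare := poincareInequality_iInf_rayleighQuotient D
  set κ : ℝ := ⨅ u : {u : EuclideanSpace ℝ D // u ≠ 0},
    RCLike.re ⟪dirichletOperator D u, (u : EuclideanSpace ℝ D)⟫ / ‖(u : EuclideanSpace ℝ D)‖ ^ 2
  have hδ2 : δ ^ 2 ≠ 0 := by positivity
  refine ⟨(δ ^ 2)⁻¹ * κ, ⟨zeroExtension D u, ?_, fun x hx => zeroExtension_of_notMem u hx.1, ?_⟩,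
    by rwa [mul_inv_cancel_left₀ hδ2]⟩
  · by_contra! h
    exact hu.2 (PiLp.ext fun x => by rw [← zeroExtension_apply, h x x.2]; rfl)
  · intro x hx
    have heig : dirichletOperator D u ⟨x, hx⟩ = (κ • u) ⟨x, hx⟩ := by
      rw [hu.apply_eq_smul]
      rfl
    rw [dirichletOperator_apply, PiLp.smul_apply, smul_eq_mul, ← zeroExtension_apply] at heig
    rw [discreteLaplacian_eq, ← mul_neg, heig, mul_assoc]

theorem isDirichletEigenvalue_nonneg {δ μ : ℝ}
    (h : IsDirichletEigenvalue δ (D : Set (Fin n → ℤ)) μ) :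
    0 ≤ μ := by
  obtain ⟨f, ⟨x, hx, hfx⟩, hboundary, heig⟩ := h
  set v : (Fin n → ℤ) → ℝ := (D : Set (Fin n → ℤ)).indicator f
  have hv (y : Fin n → ℤ) (hy : y ∉ D) : v y = 0 := Set.indicator_of_notMem hy f
  have hvD (y : Fin n → ℤ) (hy : y ∈ D) : v y = f y := Set.indicator_of_mem hy f
  have hlap (y : Fin n → ℤ) (hy : y ∈ D) : latticeLaplacian v y = latticeLaplacian f y := by
    refine latticeLaplacian_congr (hvD y hy) fun z hyz => ?_
    by_cases hz : z ∈ D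
    · exact hvD z hz
    · rw [hv z hz, hboundary z ⟨hz, y, hy, hyz.symm⟩]
  have hpos : 0 < ∑ y ∈ D, v y ^ 2 :=
    Finset.sum_pos' (fun _ _ => sq_nonneg _) ⟨x, hx, by rw [hvD x hx]; positivity⟩
  have henergy : 0 ≤ (δ ^ 2)⁻¹ * ∑ y ∈ D, v y * -latticeLaplacian v y :=
    mul_nonneg (by positivity) (dirichletEnergy_nonneg hv)
  refine nonneg_of_mul_nonneg_left (henergy.trans_eq ?_) hpos
  rw [Finset.mul_sum, Finset.mul_sum]
  refine Finset.sum_congr rfl fun y hy => ?_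
  have := heig y hy
  rw [discreteLaplacian_eq] at this
  rw [hlap y hy, hvD y hy]
  linear_combination f y * this

theorem firstDirichletEigenvalue_nonneg (δ : ℝ) (D : Finset (Fin n → ℤ)) :
    0 ≤ firstDirichletEigenvalue δ (D : Set (Fin n → ℤ)) :=
  Real.sInf_nonneg fun _ => isDirichletEigenvalue_nonneg

theorem poincareInequality_firstDirichletEigenvalue {δ : ℝ} (hδ : 0 < δ) (hD : D.Nonempty) :
    PoincareInequality D (δ ^ 2 * firstDirichletEigenvalue δ (D : Set (Fin n → ℤ))) := by
  obtain ⟨μ, hμ, hpoincare⟩ := exists_isDirichletEigenvalue_poincareInequality hδ hD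
  refine hpoincare.mono (mul_le_mul_of_nonneg_left ?_ (sq_nonneg δ))
  exact csInf_le ⟨0, fun _ => isDirichletEigenvalue_nonneg⟩ hμ

theorem mul_growthExponent {δ : ℝ} (hδ : 0 < δ) (D : Set (Fin n → ℤ)) :
    δ * growthExponent δ D = Real.arcosh (1 + δ ^ 2 * firstDirichletEigenvalue δ D / 2) :=
  mul_inv_cancel_left₀ hδ.ne' _

theorem mul_growthExponent_nonneg {δ : ℝ} (hδ : 0 < δ) (D : Finset (Fin n → ℤ)) :
    0 ≤ δ * growthExponent δ (D : Set (Fin n → ℤ)) := by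
  have := firstDirichletEigenvalue_nonneg δ D
  rw [mul_growthExponent hδ]
  exact Real.arcosh_nonneg (le_add_of_nonneg_right (by positivity))

theorem poincareInequality_two_mul_cosh_growthExponent {δ : ℝ} (hδ : 0 < δ) (hD : D.Nonempty) :
    PoincareInequality D
      (2 * Real.cosh (δ * growthExponent δ (D : Set (Fin n → ℤ))) - 2) := by
  have := firstDirichletEigenvalue_nonneg δ D
  rw [mul_growthExponent hδ, Real.cosh_arcosh (le_add_of_nonneg_right (by positivity))]
  convert poincareInequality_firstDirichletEigenvalue hδ hD using 1
  ring

end DirichletSpectrum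

section GrowthRateBound

variable {n : ℕ}

/-- The first Dirichlet eigenfunction of the interval `[-m, m]` of `ℤ`, extended by zero; products
of translates of it are the test functions that bound Poincaré constants from above. -/
noncomputable def intervalCosine (m : ℕ) (k : ℤ) : ℝ :=
  if |k| ≤ m then Real.cos (Real.pi / (2 * (m + 1)) * k) else 0

theorem intervalCosine_of_lt {m : ℕ} {k : ℤ} (hk : (m : ℤ) < |k|) : intervalCosine m k = 0 :=
  if_neg hk.not_ge

theorem intervalCosine_eq_cos {m : ℕ} {k : ℤ} (hk : |k| ≤ m + 1) :
    intervalCosine m k = Real.cos (Real.pi / (2 * (m + 1)) * k) := by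
  rcases hk.lt_or_eq.imp_left Int.lt_add_one_iff.1 with h | h
  · exact if_pos h
  · rw [intervalCosine_of_lt (by lia), ← Real.cos_abs, abs_mul, ← Int.cast_abs, h,
      abs_of_pos (by positivity)]
    push_cast
    rw [← Real.cos_pi_div_two]
    congr 1
    field_simp

theorem intervalCosine_nonneg (m : ℕ) (k : ℤ) : 0 ≤ intervalCosine m k := by
  rw [intervalCosine]
  split_ifs with hk
  · have hk' : |(k : ℝ)| ≤ m + 1 := by exact_mod_cast hk.trans (by lia)
    have habs : |Real.pi / (2 * (m + 1)) * k| ≤ Real.pi / 2 := by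
      rw [abs_mul, abs_of_pos (by positivity)]
      calc Real.pi / (2 * (m + 1)) * |(k : ℝ)| ≤ Real.pi / (2 * (m + 1)) * (m + 1) := by gcongr
        _ = Real.pi / 2 := by field_simp
    exact Real.cos_nonneg_of_neg_pi_div_two_le_of_le (abs_le.1 habs).1 (abs_le.1 habs).2
  · exact le_rfl

theorem intervalCosine_supersolution (m : ℕ) (k : ℤ) :
    2 * intervalCosine m k - (intervalCosine m (k + 1) + intervalCosine m (k - 1)) ≤
      (Real.pi / (2 * (m + 1))) ^ 2 * intervalCosine m k := by
  by_cases hk : |k| ≤ m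
  · have hcos := Real.one_sub_sq_div_two_le_cos (x := Real.pi / (2 * (m + 1)))
    have hnonneg := intervalCosine_nonneg m k
    rw [intervalCosine_eq_cos (hk.trans (by lia))] at hnonneg ⊢
    rw [abs_le] at hk
    rw [intervalCosine_eq_cos (abs_le.2 ⟨by lia, by lia⟩),
      intervalCosine_eq_cos (abs_le.2 ⟨by lia, by lia⟩)]
    push_cast
    rw [cos_mul_add_one_add_cos_mul_sub_one]
    nlinarith
  · rw [intervalCosine_of_lt (not_le.1 hk)]
    linarith [intervalCosine_nonneg m (k + 1), intervalCosine_nonneg m (k - 1)]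

theorem PoincareInequality.le_of_box_subset {D : Finset (Fin n → ℤ)} {κ : ℝ}
    (h : PoincareInequality D κ) {c : Fin n → ℤ} {m : ℕ}
    (hbox : ∀ x : Fin n → ℤ, (∀ j, |x j - c j| ≤ m) → x ∈ D) :
    κ ≤ n * (Real.pi / (2 * (m + 1))) ^ 2 := by
  refine h.le_of_supersolution (v := fun x => ∏ j, intervalCosine m (x j - c j)) ?_ ?_ ?_ ?_
  · intro x hx
    obtain ⟨j, hj⟩ := not_forall.1 (mt (hbox x) hx)
    exact Finset.prod_eq_zero (Finset.mem_univ j) (intervalCosine_of_lt (not_le.1 hj))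
  · exact fun x => Finset.prod_nonneg fun j _ => intervalCosine_nonneg m _
  · exact ⟨c, hbox c (by simp), by simp [intervalCosine]⟩
  · intro x _
    rw [latticeLaplacian_prod (fun j t => intervalCosine m (t - c j)), ← Finset.sum_neg_distrib]
    calc _ ≤ ∑ j, (Real.pi / (2 * (m + 1))) ^ 2 * ∏ i, intervalCosine m (x i - c i) := by
          refine Finset.sum_le_sum fun j _ => ?_
          rw [← Finset.mul_prod_erase _ _ (Finset.mem_univ j), ← mul_assoc, ← neg_mul]
          refine mul_le_mul_of_nonneg_right ?_
            (Finset.prod_nonneg fun i _ => intervalCosine_nonneg m _)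
          rw [neg_sub, add_sub_right_comm, sub_right_comm]
          exact intervalCosine_supersolution m (x j - c j)
      _ = _ := by simp [mul_assoc]

theorem sq_le_two_mul_cosh_sub_two (a : ℝ) : a ^ 2 ≤ 2 * Real.cosh a - 2 := by
  have hcosh : Real.cosh a = 1 + 2 * Real.sinh (a / 2) ^ 2 := by
    rw [← mul_div_cancel₀ a (two_ne_zero' ℝ), Real.cosh_two_mul, Real.cosh_sq]
    ring_nf
  have hsinh : |a / 2| ≤ |Real.sinh (a / 2)| := by
    rw [Real.abs_sinh]
    exact Real.self_le_sinh_iff.2 (abs_nonneg _)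
  rw [← sq_le_sq] at hsinh
  linarith

theorem rate_le_of_box_subset {D : Finset (Fin n → ℤ)} {α : ℝ}
    (h : PoincareInequality D (2 * Real.cosh α - 2)) {c : Fin n → ℤ} {m : ℕ}
    (hbox : ∀ x : Fin n → ℤ, (∀ j, |x j - c j| ≤ m) → x ∈ D) :
    α ≤ n * (Real.pi / (2 * (m + 1))) := by
  refine (abs_le_of_sq_le_sq' ?_ (by positivity)).2
  calc α ^ 2 ≤ 2 * Real.cosh α - 2 := sq_le_two_mul_cosh_sub_two α
    _ ≤ n * (Real.pi / (2 * (m + 1))) ^ 2 := h.le_of_box_subset hbox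
    _ ≤ n ^ 2 * (Real.pi / (2 * (m + 1))) ^ 2 := by
      gcongr
      exact_mod_cast Nat.le_self_pow two_ne_zero n
    _ = (n * (Real.pi / (2 * (m + 1)))) ^ 2 := (mul_pow _ _ _).symm

end GrowthRateBound

section MeshPoints

variable {n : ℕ} {Ω : Set (EuclideanSpace ℝ (Fin n))}

theorem exists_box_subset_meshPoints (hΩ : IsOpen Ω) (hne : Ω.Nonempty) :
    ∃ s : ℝ, 0 < s ∧ ∀ δ : ℝ, 0 < δ → (meshPoints δ Ω).Nonempty →
      ∃ c : Fin n → ℤ, ∀ x : Fin n → ℤ, (∀ j, |x j - c j| ≤ ⌊s / δ⌋₊) → x ∈ meshPoints δ Ω := by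
  obtain ⟨p, hp⟩ := hne
  obtain ⟨s, hs, hball⟩ := Metric.isOpen_iff.1 (hΩ.preimage (PiLp.continuous_toLp 2 _)) p.ofLp hp
  refine ⟨s / 2, by positivity, fun δ hδ ⟨c, hc⟩ => ?_⟩
  rcases lt_or_ge (s / 2) δ with hlarge | hsmall
  · have hm : ⌊s / 2 / δ⌋₊ = 0 := Nat.floor_eq_zero.2 ((div_lt_one hδ).2 hlarge)
    refine ⟨c, fun x hx => ?_⟩
    have : x = c := funext fun j => by simpa [hm, sub_eq_zero] using hx j
    rwa [this]
  · refine ⟨fun j => round (p j / δ), fun x hx => hball ?_⟩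
    rw [Metric.mem_ball, dist_pi_lt_iff hs]
    intro j
    have hbox : |(x j : ℝ) - round (p j / δ)| ≤ s / 2 / δ := by
      have : |(x j : ℝ) - round (p j / δ)| ≤ ⌊s / 2 / δ⌋₊ := by exact_mod_cast hx j
      exact this.trans (Nat.floor_le (by positivity))
    calc dist (δ * (x j : ℝ)) (p j) = δ * |(x j : ℝ) - p j / δ| := by
          rw [Real.dist_eq, ← abs_of_pos hδ, ← abs_mul, abs_of_pos hδ, mul_sub,
            mul_div_cancel₀ _ hδ.ne']
      _ ≤ δ * (|(x j : ℝ) - round (p j / δ)| + |round (p j / δ) - p j / δ|) := by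
          gcongr
          exact abs_sub_le _ _ _
      _ ≤ δ * (s / 2 / δ + 1 / 2) := by
          gcongr
          rw [abs_sub_comm]
          exact abs_sub_round _
      _ = s / 2 + δ / 2 := by field_simp
      _ < s := by linarith

theorem exists_rate_mul_ceil_inv_le (hΩ : IsOpen Ω) (hne : Ω.Nonempty) :
    ∃ K : ℝ, ∀ δ : ℝ, 0 < δ → ∀ D : Finset (Fin n → ℤ), D = meshPoints δ Ω → D.Nonempty →
      ∀ α : ℝ, PoincareInequality D (2 * Real.cosh α - 2) → α * ⌈δ⁻¹⌉₊ ≤ K := by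
  obtain ⟨s, hs, hbox⟩ := exists_box_subset_meshPoints hΩ hne
  refine ⟨n * (Real.pi / 2) / s + n * (Real.pi / 2), fun δ hδ D hDΩ hD α hα => ?_⟩
  obtain ⟨c, hc⟩ := hbox δ hδ (hDΩ ▸ hD)
  have hrate := rate_le_of_box_subset hα fun x hx => Finset.mem_coe.1 (hDΩ ▸ hc x hx)
  have hceil : (⌈δ⁻¹⌉₊ : ℝ) ≤ δ⁻¹ + 1 := (Nat.ceil_lt_add_one (by positivity)).le
  set m : ℕ := ⌊s / δ⌋₊
  have hm : s / δ ≤ m + 1 := (Nat.lt_floor_add_one _).le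
  calc α * ⌈δ⁻¹⌉₊ ≤ n * (Real.pi / (2 * (m + 1))) * (δ⁻¹ + 1) := by gcongr
    _ = n * (Real.pi / 2) * (δ⁻¹ / (m + 1)) + n * (Real.pi / 2) / (m + 1) := by
        field_simp
    _ ≤ n * (Real.pi / 2) * s⁻¹ + n * (Real.pi / 2) := by
        gcongr
        · rw [div_le_iff₀ (by positivity), ← div_eq_inv_mul, le_div_iff₀ hs]
          rwa [← div_eq_inv_mul]
        · exact div_le_self (by positivity) (le_add_of_nonneg_left (Nat.cast_nonneg m))
    _ = _ := by rw [div_eq_mul_inv _ s]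

theorem exists_meshPoints_subset_box (hΩ : Bornology.IsBounded Ω) :
    ∃ R : ℕ, 0 < R ∧ ∀ δ : ℝ, 0 < δ → meshPoints δ Ω ⊆
      Fintype.piFinset fun _ : Fin n => Finset.Icc (-(R * ⌈δ⁻¹⌉₊ : ℤ)) (R * ⌈δ⁻¹⌉₊) := by
  obtain ⟨R, hR, hnorm⟩ := hΩ.exists_pos_norm_le
  refine ⟨⌈R⌉₊, Nat.ceil_pos.2 hR, fun δ hδ x hx => ?_⟩
  simp only [Finset.mem_coe, Fintype.mem_piFinset, Finset.mem_Icc, ← abs_le]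
  intro j
  have hcoord : δ * |(x j : ℝ)| ≤ R := by
    have := (PiLp.norm_apply_le
      (WithLp.toLp 2 fun i => δ * (x i : ℝ) : EuclideanSpace ℝ (Fin n)) j).trans (hnorm _ hx)
    rwa [Real.norm_eq_abs, abs_mul, abs_of_pos hδ] at this
  have : |(x j : ℝ)| ≤ ⌈R⌉₊ * ⌈δ⁻¹⌉₊ :=
    calc |(x j : ℝ)| ≤ R * δ⁻¹ := by rwa [← div_eq_mul_inv, le_div_iff₀' hδ]
      _ ≤ ⌈R⌉₊ * ⌈δ⁻¹⌉₊ := by gcongr <;> exact Nat.le_ceil _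
  exact_mod_cast this

theorem finite_meshPoints (hΩ : Bornology.IsBounded Ω) {δ : ℝ} (hδ : 0 < δ) :
    (meshPoints δ Ω).Finite := by
  obtain ⟨R, -, hsub⟩ := exists_meshPoints_subset_box hΩ
  exact (Finset.finite_toSet _).subset (hsub δ hδ)

theorem exists_card_meshPoints_le (hΩ : Bornology.IsBounded Ω) :
    ∃ A : ℝ, 0 < A ∧ ∀ δ : ℝ, 0 < δ → ∀ D : Finset (Fin n → ℤ), D = meshPoints δ Ω →
      (D.card : ℝ) ≤ A * (⌈δ⁻¹⌉₊ : ℝ) ^ n := by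
  obtain ⟨R, hR, hsub⟩ := exists_meshPoints_subset_box hΩ
  refine ⟨(3 * R : ℝ) ^ n, by positivity, fun δ hδ D hD => ?_⟩
  have hRr : 0 < R * ⌈δ⁻¹⌉₊ := Nat.mul_pos hR (Nat.ceil_pos.2 (inv_pos.2 hδ))
  have hcard := Finset.card_le_card (Finset.coe_subset.1 (hD.trans_subset (hsub δ hδ)))
  rw [Fintype.card_piFinset_const, Int.card_Icc] at hcard
  have hside : (R * ⌈δ⁻¹⌉₊ + 1 - -(R * ⌈δ⁻¹⌉₊) : ℤ).toNat ≤ 3 * R * ⌈δ⁻¹⌉₊ := by lia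
  rw [← mul_pow]
  exact_mod_cast hcard.trans (Nat.pow_le_pow_left hside n)

end MeshPoints

section LayerDecay

variable {n L : ℕ} {D : Finset (Fin n → ℤ)} {U : ℤ → (Fin n → ℤ) → ℝ} {α : ℝ}

/-- The `ℓ²` norm over `D` of the layer of `U` at height `k`, the quantity that the Poincaré
inequality makes convex enough to be compared with a hyperbolic cosine in `k`. -/
noncomputable def layerNorm (D : Finset (Fin n → ℤ)) (U : ℤ → (Fin n → ℤ) → ℝ) (k : ℤ) : ℝ :=
  √(∑ x ∈ D, U k x ^ 2)

theorem layerNorm_nonneg (D : Finset (Fin n → ℤ)) (U : ℤ → (Fin n → ℤ) → ℝ) (k : ℤ) :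
    0 ≤ layerNorm D U k :=
  Real.sqrt_nonneg _

theorem layerNorm_sq (D : Finset (Fin n → ℤ)) (U : ℤ → (Fin n → ℤ) → ℝ) (k : ℤ) :
    layerNorm D U k ^ 2 = ∑ x ∈ D, U k x ^ 2 :=
  Real.sq_sqrt (Finset.sum_nonneg fun _ _ => sq_nonneg _)

theorem sum_mul_le_layerNorm_mul (k l : ℤ) :
    ∑ x ∈ D, U k x * U l x ≤ layerNorm D U k * layerNorm D U l :=
  Real.sum_mul_le_sqrt_mul_sqrt D _ _

theorem le_layerNorm {k : ℤ} {x : Fin n → ℤ} (hx : x ∈ D) : U k x ≤ layerNorm D U k :=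
  Real.le_sqrt_of_sq_le
    (Finset.single_le_sum (f := fun y => U k y ^ 2) (fun _ _ => sq_nonneg _) hx)

theorem sum_le_sqrt_card_mul_layerNorm (k : ℤ) :
    ∑ x ∈ D, U k x ≤ √D.card * layerNorm D U k := by
  simpa [layerNorm] using Real.sum_mul_le_sqrt_mul_sqrt D (fun _ => (1 : ℝ)) (U k)

namespace SlabSubsolution

theorem layerNorm_le_sqrt_card_mul (hU : SlabSubsolution D L U) {k : ℤ} {M : ℝ} (hM : 0 ≤ M)
    (h : ∀ x ∈ D, U k x ≤ M) : layerNorm D U k ≤ √D.card * M := by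
  rw [← Real.sqrt_sq hM, ← Real.sqrt_mul (by positivity), ← nsmul_eq_mul]
  exact Real.sqrt_le_sqrt (Finset.sum_le_card_nsmul _ _ _ fun x hx =>
    pow_le_pow_left₀ (hU.nonneg k x) (h x hx) 2)

theorem two_mul_cosh_mul_layerNorm_le (hU : SlabSubsolution D L U)
    (hα : PoincareInequality D (2 * Real.cosh α - 2)) {k : ℤ} (hk : |k| < L) :
    2 * Real.cosh α * layerNorm D U k ≤ layerNorm D U (k + 1) + layerNorm D U (k - 1) := by
  rcases (layerNorm_nonneg D U k).eq_or_lt with hzero | hpos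
  · rw [← hzero, mul_zero]
    exact add_nonneg (layerNorm_nonneg _ _ _) (layerNorm_nonneg _ _ _)
  have henergy : (2 * Real.cosh α - 2) * layerNorm D U k ^ 2 ≤
      layerNorm D U k * layerNorm D U (k + 1) + layerNorm D U k * layerNorm D U (k - 1) -
        2 * layerNorm D U k ^ 2 :=
    calc (2 * Real.cosh α - 2) * layerNorm D U k ^ 2
        ≤ ∑ x ∈ D, U k x * -latticeLaplacian (U k) x := by
          rw [layerNorm_sq]
          exact hα _ (hU.eq_zero k)
      _ ≤ ∑ x ∈ D, (U k x * U (k + 1) x + U k x * U (k - 1) x - 2 * U k x ^ 2) := by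
          refine Finset.sum_le_sum fun x hx => ?_
          have hsub := hU.subharmonic k hk x hx
          rw [layerLaplacian_apply] at hsub
          calc U k x * -latticeLaplacian (U k) x
              ≤ U k x * (U (k + 1) x + U (k - 1) x - 2 * U k x) :=
                mul_le_mul_of_nonneg_left (by linarith) (hU.nonneg k x)
            _ = _ := by ring
      _ ≤ _ := by
          rw [Finset.sum_sub_distrib, Finset.sum_add_distrib, ← Finset.mul_sum, ← layerNorm_sq]
          gcongr <;> exact sum_mul_le_layerNorm_mul _ _
  refine le_of_mul_le_mul_left ?_ hpos
  linarith

theorem layerNorm_le_mul_cosh_div (hU : SlabSubsolution D L U)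
    (hα : PoincareInequality D (2 * Real.cosh α - 2)) {S : ℝ}
    (hcap : ∀ k : ℤ, |k| = L → layerNorm D U k ≤ S) {k : ℤ} (hk : |k| ≤ L) :
    layerNorm D U k ≤ S / Real.cosh (α * L) * Real.cosh (α * k) := by
  refine sub_nonpos.1 (nonpos_of_midpoint_convex_of_pos
    (m := fun k => layerNorm D U k - S / Real.cosh (α * L) * Real.cosh (α * k)) ?_ ?_ hk)
  · intro l hl hpos
    have hcosh := mul_le_mul_of_nonneg_right (Real.one_le_cosh α) hpos.le
    have hstep := hU.two_mul_cosh_mul_layerNorm_le hα hl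
    have hcomparison : S / Real.cosh (α * L) * (Real.cosh (α * (l + 1)) + Real.cosh (α * (l - 1)))
        = 2 * Real.cosh α * (S / Real.cosh (α * L) * Real.cosh (α * l)) := by
      rw [cosh_mul_add_one_add_cosh_mul_sub_one]
      ring
    push_cast
    linarith
  · intro l hl
    have hcosh : Real.cosh (α * l) = Real.cosh (α * L) := by
      rw [← Real.cosh_abs, abs_mul, ← Int.cast_abs, hl, ← Real.cosh_abs (α * L), abs_mul]
      simp
    rw [hcosh, div_mul_cancel₀ _ (Real.cosh_pos _).ne']
    exact sub_nonpos.2 (hcap l hl)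

theorem layerNorm_le_mul_exp_neg (hU : SlabSubsolution D L U)
    (hα : PoincareInequality D (2 * Real.cosh α - 2)) {M : ℝ} (hM : 0 ≤ M)
    (hcap : ∀ k : ℤ, |k| = L → ∀ x ∈ D, U k x ≤ M) {k : ℤ} (hk : |k| ≤ L) :
    layerNorm D U k ≤ √D.card * M * (2 * Real.exp (-(α * L))) * Real.cosh (α * k) := by
  refine (hU.layerNorm_le_mul_cosh_div hα
    (fun l hl => hU.layerNorm_le_sqrt_card_mul hM (hcap l hl)) hk).trans ?_
  rw [div_eq_mul_inv]
  gcongr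
  exact inv_cosh_le_two_mul_exp_neg _

theorem sum_layer_le (hU : SlabSubsolution D L U)
    (hα : PoincareInequality D (2 * Real.cosh α - 2)) {M : ℝ} (hM : 0 ≤ M)
    (hcap : ∀ k : ℤ, |k| = L → ∀ x ∈ D, U k x ≤ M) {k : ℤ} (hk : |k| ≤ L) :
    ∑ x ∈ D, U k x ≤ D.card * M * (2 * Real.exp (-(α * L))) * Real.cosh (α * k) :=
  calc ∑ x ∈ D, U k x ≤ √D.card * layerNorm D U k := sum_le_sqrt_card_mul_layerNorm k
    _ ≤ √D.card * (√D.card * M * (2 * Real.exp (-(α * L))) * Real.cosh (α * k)) := by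
        gcongr
        exact hU.layerNorm_le_mul_exp_neg hα hM hcap hk
    _ = √D.card * √D.card * M * (2 * Real.exp (-(α * L))) * Real.cosh (α * k) := by ring
    _ = _ := by rw [Real.mul_self_sqrt (Nat.cast_nonneg _)]

end SlabSubsolution

theorem cosh_le_exp {t : ℝ} (ht : 0 ≤ t) : Real.cosh t ≤ Real.exp t := by
  rw [← Real.cosh_add_sinh]
  exact le_add_of_nonneg_right (Real.sinh_nonneg_iff.2 ht)

theorem exists_slabSubsolution_le_mul_exp_neg (n : ℕ) :
    ∃ C : ℝ, 0 < C ∧ ∀ r : ℕ, 0 < r → ∀ (D : Finset (Fin n → ℤ)) (α : ℝ), 0 ≤ α →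
      PoincareInequality D (2 * Real.cosh α - 2) → ∀ (L : ℕ) (U : ℤ → (Fin n → ℤ) → ℝ) (M : ℝ),
      SlabSubsolution D L U → 0 ≤ M → (∀ k : ℤ, |k| = L → ∀ x ∈ D, U k x ≤ M) → ∀ x,
      U 0 x ≤ (C * D.card / r ^ n + 1) * Real.exp (α * r) * M * Real.exp (-(α * L)) := by
  obtain ⟨C, hC, hmean⟩ := exists_meanValue_inequality n
  refine ⟨4 * C, by positivity, fun r hr D α hα0 hα L U M hU hM hcap x => ?_⟩
  rcases le_or_gt r L with hrL | hLr
  · have hlayer {k : ℤ} (hk : |k| = r) : ∑ y ∈ D, U k y ≤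
        D.card * M * (2 * Real.exp (-(α * L))) * Real.exp (α * r) := by
      refine (hU.sum_layer_le hα hM hcap (by rw [hk]; exact_mod_cast hrL)).trans ?_
      have hcosh : Real.cosh (α * k) ≤ Real.exp (α * r) := by
        rw [← Real.cosh_abs, abs_mul, abs_of_nonneg hα0, ← Int.cast_abs, hk, Int.cast_natCast]
        exact cosh_le_exp (by positivity)
      gcongr
    calc U 0 x ≤ C / r ^ n * ∑ y ∈ D, (U r y + U (-r) y) := hmean r hr D U (hU.mono hrL) x
      _ ≤ C / r ^ n * (D.card * M * (2 * Real.exp (-(α * L))) * Real.exp (α * r) +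
            D.card * M * (2 * Real.exp (-(α * L))) * Real.exp (α * r)) := by
          rw [Finset.sum_add_distrib]
          gcongr
          · exact hlayer (by simp)
          · exact hlayer (by simp)
      _ = 4 * C * D.card / r ^ n * Real.exp (α * r) * M * Real.exp (-(α * L)) := by ring
      _ ≤ _ := by
          gcongr
          exact le_add_of_nonneg_right zero_le_one
  · have hexp : 1 ≤ Real.exp (α * r) * Real.exp (-(α * L)) := by
      rw [← Real.exp_add, ← sub_eq_add_neg, ← mul_sub, Real.one_le_exp_iff]
      exact mul_nonneg hα0 (sub_nonneg.2 (by exact_mod_cast hLr.le))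
    calc U 0 x ≤ M := hU.le_of_caps_le hM hcap (by simp) x
      _ ≤ M * (Real.exp (α * r) * Real.exp (-(α * L))) := le_mul_of_one_le_right hM hexp
      _ = 1 * Real.exp (α * r) * M * Real.exp (-(α * L)) := by ring
      _ ≤ _ := by
          gcongr
          exact le_add_of_nonneg_left (by positivity)

theorem nonpos_of_slabSubsolution_of_growth (hα : PoincareInequality D (2 * Real.cosh α - 2))
    (hU : ∀ L, SlabSubsolution D L U)
    (hgrowth : ∀ ε : ℝ, 0 < ε → ∀ᶠ L : ℕ in Filter.atTop, ∀ k : ℤ, |k| = L → ∀ x ∈ D,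
      U k x ≤ ε * Real.exp (α * L))
    (k : ℤ) {x : Fin n → ℤ} (hx : x ∈ D) : U k x ≤ 0 := by
  have hbound {ε : ℝ} (hε : 0 < ε) : U k x ≤ 2 * √D.card * Real.cosh (α * k) * ε := by
    obtain ⟨L, hcap, hkL⟩ :=
      ((hgrowth ε hε).and (Filter.eventually_ge_atTop k.natAbs)).exists
    calc U k x ≤ layerNorm D U k := le_layerNorm hx
      _ ≤ √D.card * (ε * Real.exp (α * L)) * (2 * Real.exp (-(α * L))) * Real.cosh (α * k) :=
          (hU L).layerNorm_le_mul_exp_neg hα (by positivity) hcap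
            (by rw [Int.abs_eq_natAbs]; exact_mod_cast hkL)
      _ = 2 * √D.card * Real.cosh (α * k) * ε * (Real.exp (α * L) * Real.exp (-(α * L))) := by
          ring
      _ = _ := by rw [← Real.exp_add, add_neg_cancel, Real.exp_zero, mul_one]
  have hlim : Filter.Tendsto (fun ε => 2 * √D.card * Real.cosh (α * k) * ε)
      (nhdsWithin 0 (Set.Ioi 0)) (nhds 0) :=
    tendsto_nhdsWithin_of_tendsto_nhds (Continuous.tendsto' (by fun_prop) _ _ (mul_zero _))
  exact ge_of_tendsto hlim (eventually_mem_nhdsWithin.mono fun ε hε => hbound hε)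

end LayerDecay

section Layers

variable {n L : ℕ} {δ : ℝ} {E : Set (Fin n → ℤ)} {x : Fin n → ℤ} {k : ℤ}

/-- The point of the lattice `ℤⁿ⁺¹` that lies over `x` at height `k`; the height is the last
coordinate, as in `latticeHeight`. -/
def latticePoint (x : Fin n → ℤ) (k : ℤ) : Fin (n + 1) → ℤ :=
  Fin.snoc (α := fun _ => ℤ) x k

/-- The horizontal layers of a function on `ℤⁿ⁺¹`: the form in which `layerLaplacian` takes it. -/
def layers (h : (Fin (n + 1) → ℤ) → ℝ) (k : ℤ) (x : Fin n → ℤ) : ℝ :=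
  h (latticePoint x k)

theorem exists_latticePoint_eq (z : Fin (n + 1) → ℤ) : ∃ x k, latticePoint x k = z :=
  ⟨Fin.init z, z (Fin.last n), Fin.snoc_init_self z⟩

theorem latticeHeight_latticePoint (δ : ℝ) (x : Fin n → ℤ) (k : ℤ) :
    latticeHeight δ (latticePoint x k) = δ * k := by
  simp [latticeHeight, latticePoint]

theorem abs_latticeHeight_latticePoint (hδ : 0 < δ) (x : Fin n → ℤ) (k : ℤ) :
    |latticeHeight δ (latticePoint x k)| = |(k : ℝ)| * δ := by
  rw [latticeHeight_latticePoint, abs_mul, abs_of_pos hδ, mul_comm]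

theorem latticePoint_mem_latticeCylinder : latticePoint x k ∈ latticeCylinder E ↔ x ∈ E := by
  simp [latticeCylinder, latticePoint]

theorem latticePoint_mem_latticeSlab {S : Set ℝ} :
    latticePoint x k ∈ latticeSlab δ E S ↔ x ∈ E ∧ latticeHeight δ (latticePoint x k) ∈ S := by
  simp [latticeSlab, latticePoint]

theorem latticePoint_mem_latticeSlab_Ioo (hδ : 0 < δ) :
    latticePoint x k ∈ latticeSlab δ E (Set.Ioo (-(L * δ)) (L * δ)) ↔ x ∈ E ∧ |k| < L := by
  rw [latticePoint_mem_latticeSlab, Set.mem_Ioo, ← abs_lt, abs_latticeHeight_latticePoint hδ,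
    mul_lt_mul_iff_left₀ hδ]
  norm_cast

theorem latticePoint_mem_latticeSlab_Icc (hδ : 0 < δ) :
    latticePoint x k ∈ latticeSlab δ E (Set.Icc (-(L * δ)) (L * δ)) ↔ x ∈ E ∧ |k| ≤ L := by
  rw [latticePoint_mem_latticeSlab, Set.mem_Icc, ← abs_le, abs_latticeHeight_latticePoint hδ,
    mul_le_mul_iff_left₀ hδ]
  norm_cast

theorem latticePoint_mem_latticeSlab_caps (hδ : 0 < δ) :
    latticePoint x k ∈ latticeSlab δ E {-(L * δ), L * δ} ↔ x ∈ E ∧ |k| = L := by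
  rw [latticePoint_mem_latticeSlab, Set.mem_insert_iff, Set.mem_singleton_iff, or_comm,
    ← abs_eq (by positivity), abs_latticeHeight_latticePoint hδ, mul_left_inj' hδ.ne']
  norm_cast

theorem latticePoint_mem_latticeSlab_zero (hδ : 0 < δ) :
    latticePoint x k ∈ latticeSlab δ E {0} ↔ x ∈ E ∧ k = 0 := by
  rw [latticePoint_mem_latticeSlab, latticeHeight_latticePoint, Set.mem_singleton_iff,
    mul_eq_zero_iff_left hδ.ne', Int.cast_eq_zero]

theorem latticePoint_add_single_castSucc (x : Fin n → ℤ) (k : ℤ) (j : Fin n) (a : ℤ) :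
    latticePoint x k + Pi.single j.castSucc a = latticePoint (x + Pi.single j a) k := by
  ext i
  cases i using Fin.lastCases <;> simp [latticePoint, Pi.single_apply]

theorem latticePoint_add_single_last (x : Fin n → ℤ) (k a : ℤ) :
    latticePoint x k + Pi.single (Fin.last n) a = latticePoint x (k + a) := by
  ext i
  cases i using Fin.lastCases <;> simp [latticePoint]

theorem discreteLaplacian_latticePoint (δ : ℝ) (h : (Fin (n + 1) → ℤ) → ℝ)
    (x : Fin n → ℤ) (k : ℤ) :
    discreteLaplacian δ h (latticePoint x k) = (δ ^ 2)⁻¹ * layerLaplacian (layers h) k x := by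
  rw [discreteLaplacian_eq, latticeLaplacian_apply, layerLaplacian_apply, latticeLaplacian_apply,
    Fin.sum_univ_castSucc]
  simp only [sub_eq_add_neg (latticePoint x k), ← Pi.single_neg, latticePoint_add_single_castSucc,
    latticePoint_add_single_last, layers, sub_eq_add_neg x, sub_eq_add_neg k]

theorem discreteLaplacian_latticePoint_eq_zero_iff (hδ : 0 < δ) {h : (Fin (n + 1) → ℤ) → ℝ} :
    discreteLaplacian δ h (latticePoint x k) = 0 ↔ layerLaplacian (layers h) k x = 0 := by
  rw [discreteLaplacian_latticePoint, mul_eq_zero_iff_left (by positivity)]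

theorem eventually_abs_layers_le_of_isLittleO (hδ : 0 < δ) {h : (Fin (n + 1) → ℤ) → ℝ} {a : ℝ}
    (hh : h =o[Filter.comap (fun z => |latticeHeight δ z|) Filter.atTop ⊓
        Filter.principal (latticeCylinder E)] fun z => Real.exp (a * |latticeHeight δ z|))
    {ε : ℝ} (hε : 0 < ε) :
    ∀ᶠ L : ℕ in Filter.atTop, ∀ k : ℤ, |k| = L → ∀ x ∈ E,
      |layers h k x| ≤ ε * Real.exp (δ * a * L) := by
  have hbound := hh.bound hε
  rw [Filter.eventually_inf_principal, Filter.eventually_comap] at hbound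
  have hheight : Filter.Tendsto (fun L : ℕ => L * δ) Filter.atTop Filter.atTop :=
    tendsto_natCast_atTop_atTop.atTop_mul_const hδ
  filter_upwards [hheight.eventually hbound] with L hL k hk x hx
  have habs : |latticeHeight δ (latticePoint x k)| = L * δ := by
    rw [abs_latticeHeight_latticePoint hδ, ← Int.cast_abs, hk, Int.cast_natCast]
  have := hL _ habs (latticePoint_mem_latticeCylinder.2 hx)
  rwa [habs, Real.norm_eq_abs, Real.norm_eq_abs, Real.abs_exp,
    show a * (L * δ) = δ * a * L by ring] at this

end Layers

section Excess

variable {n L : ℕ} {D : Finset (Fin n → ℤ)} {H : ℤ → (Fin n → ℤ) → ℝ} {B : ℝ} {k : ℤ}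
  {x : Fin n → ℤ}

theorem LatticeNeighbor.mem_discreteClosure {y : Fin n → ℤ} (h : LatticeNeighbor x y)
    (hx : x ∈ D) : y ∈ discreteClosure (D : Set (Fin n → ℤ)) :=
  or_iff_not_imp_left.2 fun hy => ⟨hy, x, hx, h.symm⟩

theorem discreteBoundary_nonempty (hn : 1 ≤ n) (hD : D.Nonempty) :
    (discreteBoundary (D : Set (Fin n → ℤ))).Nonempty := by
  obtain ⟨x, hx, hmax⟩ := D.exists_max_image (fun x => x ⟨0, hn⟩) hD
  refine ⟨x + Pi.single ⟨0, hn⟩ 1, fun h => ?_, x, hx, ⟨0, hn⟩, .inr ?_⟩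
  · simpa using hmax _ h
  · exact (add_sub_cancel_right _ _).symm

/-- The amount by which `|H|` exceeds the level `B` over `D`, extended by zero; it is a
subsolution when `H` is harmonic and `|H| ≤ B` on the lateral boundary. -/
noncomputable def excess (D : Finset (Fin n → ℤ)) (H : ℤ → (Fin n → ℤ) → ℝ) (B : ℝ) (k : ℤ) :
    (Fin n → ℤ) → ℝ :=
  (D : Set (Fin n → ℤ)).indicator fun x => max (|H k x| - B) 0

theorem excess_of_mem (hx : x ∈ D) : excess D H B k x = max (|H k x| - B) 0 :=
  Set.indicator_of_mem (Finset.mem_coe.2 hx) _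

theorem excess_of_notMem (hx : x ∉ D) : excess D H B k x = 0 :=
  Set.indicator_of_notMem (mt Finset.mem_coe.1 hx) _

theorem excess_nonneg : 0 ≤ excess D H B k x :=
  Set.indicator_nonneg (fun _ _ => le_max_right _ _) x

theorem excess_le {M : ℝ} (hB : 0 ≤ B) (hx : x ∈ D) (hM : |H k x| ≤ M) : excess D H B k x ≤ M := by
  rw [excess_of_mem hx]
  exact max_le ((sub_le_self _ hB).trans hM) ((abs_nonneg _).trans hM)

theorem abs_sub_le_excess_of_mem (hx : x ∈ D) : |H k x| - B ≤ excess D H B k x :=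
  (le_max_left _ _).trans_eq (excess_of_mem hx).symm

theorem abs_sub_le_excess (hB : ∀ y ∈ discreteBoundary (D : Set (Fin n → ℤ)), |H k y| ≤ B)
    (hx : x ∈ discreteClosure (D : Set (Fin n → ℤ))) : |H k x| - B ≤ excess D H B k x :=
  hx.elim abs_sub_le_excess_of_mem fun hx => (sub_nonpos.2 (hB x hx)).trans excess_nonneg

theorem layerLaplacian_excess_nonneg (hx : x ∈ D) (hH : layerLaplacian H k x = 0)
    (hB : ∀ y ∈ discreteBoundary (D : Set (Fin n → ℤ)), |H k y| ≤ B) :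
    0 ≤ layerLaplacian (excess D H B) k x := by
  rcases le_or_gt (|H k x|) B with hle | hlt
  · rw [← layerLaplacian_const 0 k x]
    refine layerLaplacian_le_of_touches ?_ (fun _ _ => excess_nonneg) excess_nonneg excess_nonneg
    rw [excess_of_mem hx, max_eq_right (sub_nonpos.2 hle)]
  · obtain ⟨σ, hσ, hHσ⟩ : ∃ σ : ℝ, |σ| = 1 ∧ σ * H k x = |H k x| := by
      rcases abs_choice (H k x) with h | h
      · exact ⟨1, abs_one, by rw [one_mul, h]⟩
      · exact ⟨-1, by rw [abs_neg, abs_one], by rw [neg_one_mul, h]⟩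
    have le_abs (l : ℤ) (y : Fin n → ℤ) : σ * H l y - B ≤ |H l y| - B :=
      sub_le_sub_right ((le_abs_self _).trans_eq (by rw [abs_mul, hσ, one_mul])) B
    have hharmonic : layerLaplacian (σ • H - fun _ _ => B) k x = 0 := by
      rw [map_sub, map_smul, Pi.sub_apply, Pi.sub_apply, Pi.smul_apply, Pi.smul_apply, hH,
        layerLaplacian_const, smul_zero, sub_zero]
    rw [← hharmonic]
    refine layerLaplacian_le_of_touches ?_ (fun y hy => ?_) ?_ ?_
    · rw [excess_of_mem hx, max_eq_left (sub_nonneg.2 hlt.le), ← hHσ]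
      rfl
    · exact (le_abs k y).trans (abs_sub_le_excess hB (hy.mem_discreteClosure hx))
    · exact (le_abs _ x).trans (abs_sub_le_excess_of_mem hx)
    · exact (le_abs _ x).trans (abs_sub_le_excess_of_mem hx)

theorem slabSubsolution_excess (hH : ∀ k : ℤ, |k| < L → ∀ x ∈ D, layerLaplacian H k x = 0)
    (hB : ∀ k : ℤ, |k| < L → ∀ y ∈ discreteBoundary (D : Set (Fin n → ℤ)), |H k y| ≤ B) :
    SlabSubsolution D L (excess D H B) :=
  ⟨fun _ _ => excess_nonneg, fun _ _ hx => excess_of_notMem hx,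
    fun k hk x hx => layerLaplacian_excess_nonneg hx (hH k hk x hx) (hB k hk)⟩

end Excess

section HarmonicFunctions

variable {n : ℕ} {δ : ℝ} {h : (Fin (n + 1) → ℤ) → ℝ}

theorem exists_abs_le_of_discreteHarmonicOn_slab (hn : 1 ≤ n) :
    ∃ C : ℝ, 0 < C ∧ ∀ r : ℕ, 0 < r → ∀ δ : ℝ, 0 < δ → ∀ D : Finset (Fin n → ℤ), D.Nonempty →
      ∀ A K : ℝ, D.card ≤ A * r ^ n → δ * growthExponent δ (D : Set (Fin n → ℤ)) * r ≤ K →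
      ∀ (L : ℕ) (h : (Fin (n + 1) → ℤ) → ℝ) (M F : ℝ),
        DiscreteHarmonicOn δ h (latticeSlab δ D (Set.Ioo (-(L * δ)) (L * δ))) →
        (∀ x ∈ latticeSlab δ (discreteBoundary D) (Set.Icc (-(L * δ)) (L * δ)), |h x| ≤ F) →
        (∀ x ∈ latticeSlab δ D {-(L * δ), L * δ}, |h x| ≤ M) →
        ∀ x ∈ latticeSlab δ (discreteClosure (D : Set (Fin n → ℤ))) {0},
          |h x| ≤ F + (C * A + 1) * Real.exp K * (M + F) *
            Real.exp (-(growthExponent δ (D : Set (Fin n → ℤ)) * (L * δ))) := by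
  obtain ⟨C, hC, hdecay⟩ := exists_slabSubsolution_le_mul_exp_neg n
  refine ⟨C, hC, fun r hr δ hδ D hD A K hA hK L h M F hharm hbd hcap z hz => ?_⟩
  set a := growthExponent δ (D : Set (Fin n → ℤ))
  have hbdF {k : ℤ} (hk : |k| ≤ L) : ∀ x ∈ discreteBoundary (D : Set (Fin n → ℤ)),
      |layers h k x| ≤ F := fun x hx => hbd _ ((latticePoint_mem_latticeSlab_Icc hδ).2 ⟨hx, hk⟩)
  have hcapM {k : ℤ} (hk : |k| = L) : ∀ x ∈ D, |layers h k x| ≤ M :=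
    fun x hx => hcap _ ((latticePoint_mem_latticeSlab_caps hδ).2 ⟨hx, hk⟩)
  have hF : 0 ≤ F := by
    obtain ⟨x, hx⟩ := discreteBoundary_nonempty hn hD
    exact (abs_nonneg _).trans (hbdF (k := 0) (by simp) x hx)
  have hM : 0 ≤ M := by
    obtain ⟨x, hx⟩ := hD
    exact (abs_nonneg _).trans (hcapM (k := L) (by simp) x hx)
  have hA_nonneg : 0 ≤ A :=
    nonneg_of_mul_nonneg_left ((Nat.cast_nonneg D.card).trans hA) (by positivity)
  have hU : SlabSubsolution D L (excess D (layers h) F) :=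
    slabSubsolution_excess (fun k hk x hx => (discreteLaplacian_latticePoint_eq_zero_iff hδ).1
      (hharm _ ((latticePoint_mem_latticeSlab_Ioo hδ).2 ⟨hx, hk⟩))) fun k hk => hbdF hk.le
  obtain ⟨x, k, rfl⟩ := exists_latticePoint_eq z
  obtain ⟨hx, rfl⟩ := (latticePoint_mem_latticeSlab_zero hδ).1 hz
  calc |layers h 0 x| ≤ F + excess D (layers h) F 0 x :=
        sub_le_iff_le_add'.1 (abs_sub_le_excess (hbdF (by simp)) hx)
    _ ≤ F + (C * D.card / r ^ n + 1) * Real.exp (δ * a * r) * M * Real.exp (-(δ * a * L)) := by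
        gcongr
        exact hdecay r hr D _ (mul_growthExponent_nonneg hδ D)
          (poincareInequality_two_mul_cosh_growthExponent hδ hD) L _ M hU hM
          (fun k hk x hx => excess_le hF hx (hcapM hk x hx)) x
    _ ≤ F + (C * A + 1) * Real.exp K * (M + F) * Real.exp (-(a * (L * δ))) := by
        rw [show δ * a * L = a * (L * δ) by ring, mul_div_assoc]
        gcongr
        · exact div_le_of_le_mul₀ (by positivity) hA_nonneg hA
        · exact le_add_of_nonneg_right hF

theorem abs_le_of_discreteHarmonicOn_cylinder (hn : 1 ≤ n) (hδ : 0 < δ)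
    {D : Finset (Fin n → ℤ)} (hD : D.Nonempty) {B : ℝ}
    (hharm : DiscreteHarmonicOn δ h (latticeCylinder (D : Set (Fin n → ℤ))))
    (hgrowth : h =o[Filter.comap (fun x => |latticeHeight δ x|) Filter.atTop ⊓
        Filter.principal (latticeCylinder (D : Set (Fin n → ℤ)))]
      fun x => Real.exp (growthExponent δ (D : Set (Fin n → ℤ)) * |latticeHeight δ x|))
    (hbd : ∀ x ∈ latticeCylinder (discreteBoundary (D : Set (Fin n → ℤ))), |h x| ≤ B)
    {z : Fin (n + 1) → ℤ} (hz : z ∈ latticeCylinder (discreteClosure (D : Set (Fin n → ℤ)))) :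
    |h z| ≤ B := by
  have hbdB (k : ℤ) : ∀ x ∈ discreteBoundary (D : Set (Fin n → ℤ)), |layers h k x| ≤ B :=
    fun x hx => hbd _ (latticePoint_mem_latticeCylinder.2 hx)
  have hB : 0 ≤ B := by
    obtain ⟨x, hx⟩ := discreteBoundary_nonempty hn hD
    exact (abs_nonneg _).trans (hbdB 0 x hx)
  have hU (L : ℕ) : SlabSubsolution D L (excess D (layers h) B) :=
    slabSubsolution_excess (fun k _ x hx => (discreteLaplacian_latticePoint_eq_zero_iff hδ).1
      (hharm _ (latticePoint_mem_latticeCylinder.2 hx))) fun k _ => hbdB k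
  obtain ⟨x, k, rfl⟩ := exists_latticePoint_eq z
  rcases latticePoint_mem_latticeCylinder.1 hz with hx | hx
  · refine sub_nonpos.1 ((abs_sub_le_excess_of_mem hx).trans
      (nonpos_of_slabSubsolution_of_growth
        (poincareInequality_two_mul_cosh_growthExponent hδ hD) hU (fun ε hε => ?_) k hx))
    filter_upwards [eventually_abs_layers_le_of_isLittleO hδ hgrowth hε] with L hL l hl y hy
    exact excess_le hB hy (hL l hl y hy)
  · exact hbdB k x hx

end HarmonicFunctions

theorem theorem5_general {n : ℕ} (hn : 1 ≤ n) {Ω : Set (EuclideanSpace ℝ (Fin n))}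
    (hΩ_open : IsOpen Ω) (hΩ_ne : Ω.Nonempty) (hΩ_bdd : Bornology.IsBounded Ω) :
    (∃ C : ℝ, 0 < C ∧ ∀ δ : ℝ, 0 < δ → (meshPoints δ Ω).Nonempty →
      ∀ (L : ℕ) (h : (Fin (n + 1) → ℤ) → ℝ) (M F : ℝ),
        DiscreteHarmonicOn δ h (latticeSlab δ (meshPoints δ Ω) (Set.Ioo (-(L * δ)) (L * δ))) →
        (∀ x ∈ latticeSlab δ (discreteBoundary (meshPoints δ Ω)) (Set.Icc (-(L * δ)) (L * δ)),
          |h x| ≤ F) →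
        (∀ x ∈ latticeSlab δ (meshPoints δ Ω) {-(L * δ), L * δ}, |h x| ≤ M) →
        ∀ x ∈ latticeSlab δ (discreteClosure (meshPoints δ Ω)) {0},
          |h x| ≤ F +
            C * (M + F) * Real.exp (-(growthExponent δ (meshPoints δ Ω) * (L * δ)))) ∧
    (∀ δ : ℝ, 0 < δ → (meshPoints δ Ω).Nonempty → ∀ (h : (Fin (n + 1) → ℤ) → ℝ) (B : ℝ),
        DiscreteHarmonicOn δ h (latticeCylinder (meshPoints δ Ω)) →
        h =o[Filter.comap (fun x => |latticeHeight δ x|) Filter.atTop ⊓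
            Filter.principal (latticeCylinder (meshPoints δ Ω))]
          (fun x => Real.exp (growthExponent δ (meshPoints δ Ω) * |latticeHeight δ x|)) →
        (∀ x ∈ latticeCylinder (discreteBoundary (meshPoints δ Ω)), |h x| ≤ B) →
        ∀ x ∈ latticeCylinder (discreteClosure (meshPoints δ Ω)), |h x| ≤ B) := by
  obtain ⟨C, hC, hslab⟩ := exists_abs_le_of_discreteHarmonicOn_slab hn
  obtain ⟨A, hA, hcard⟩ := exists_card_meshPoints_le hΩ_bdd
  obtain ⟨K, hK⟩ := exists_rate_mul_ceil_inv_le hΩ_open hΩ_ne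
  refine ⟨⟨(C * A + 1) * Real.exp K, by positivity, fun δ hδ hne => ?_⟩, fun δ hδ hne => ?_⟩ <;>
    obtain ⟨D, hD⟩ := (finite_meshPoints hΩ_bdd hδ).exists_finset_coe
  · have hdensity := hcard δ hδ D hD
    have hrate := hK δ hδ D hD
    rw [← hD] at hne ⊢
    exact hslab ⌈δ⁻¹⌉₊ (Nat.ceil_pos.2 (inv_pos.2 hδ)) δ hδ D hne A K hdensity
      (hrate hne _ (poincareInequality_two_mul_cosh_growthExponent hδ hne))
  · rw [← hD] at hne ⊢
    exact fun h B hharm hgrowth hbd x hx =>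
      abs_le_of_discreteHarmonicOn_cylinder hn hδ hne hharm hgrowth hbd hx

theorem theorem5 (n : ℕ) (hn : 1 ≤ n) (Ω : Set (EuclideanSpace ℝ (Fin n)))
    (hΩ_open : IsOpen Ω) (hΩ_conn : IsConnected Ω) (hΩ_bdd : Bornology.IsBounded Ω)
    (hΩ_lip : HasLipschitzBoundary Ω) :
    (∃ C : ℝ, 0 < C ∧
      ∀ δ : ℝ, 0 < δ → IsDiscreteDomain (meshPoints δ Ω) →
      ∀ N : ℝ, 0 < N → (∃ L : ℕ, N = L * δ) →
      ∀ (h f : (Fin (n + 1) → ℤ) → ℝ) (M F : ℝ),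
        DiscreteHarmonicOn δ h (latticeSlab δ (meshPoints δ Ω) (Set.Ioo (-N) N)) →
        (∀ x ∈ latticeSlab δ (discreteBoundary (meshPoints δ Ω)) (Set.Icc (-N) N), h x = f x) →
        IsGreatest ((fun x => |f x|) ''
          latticeSlab δ (discreteBoundary (meshPoints δ Ω)) (Set.Icc (-N) N)) F →
        (∀ x ∈ latticeSlab δ (meshPoints δ Ω) {-N, N}, |h x| ≤ M) →
        ∀ x ∈ latticeSlab δ (discreteClosure (meshPoints δ Ω)) {0},
          |h x| ≤ F + C * (M + F) * Real.exp (-(growthExponent δ (meshPoints δ Ω) * N))) ∧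
    (∀ δ : ℝ, 0 < δ → IsDiscreteDomain (meshPoints δ Ω) →
      ∀ (h : (Fin (n + 1) → ℤ) → ℝ) (B : ℝ),
        DiscreteHarmonicOn δ h (latticeCylinder (meshPoints δ Ω)) →
        h =o[Filter.comap (fun x => |latticeHeight δ x|) Filter.atTop ⊓
            Filter.principal (latticeCylinder (meshPoints δ Ω))]
          (fun x => Real.exp (growthExponent δ (meshPoints δ Ω) * |latticeHeight δ x|)) →
        (∀ x ∈ latticeCylinder (discreteBoundary (meshPoints δ Ω)), |h x| ≤ B) →
        ∀ x ∈ latticeCylinder (discreteClosure (meshPoints δ Ω)), |h x| ≤ B) := by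
  have ⟨⟨C, hC, hslab⟩, hcylinder⟩ := theorem5_general hn hΩ_open hΩ_conn.nonempty hΩ_bdd
  refine ⟨⟨C, hC, ?_⟩, fun δ hδ hD => hcylinder δ hδ hD.1⟩
  rintro δ hδ hD _ - ⟨L, rfl⟩ h f M F hharm hf hF
  exact hslab δ hδ hD.1 L h M F hharm fun x hx => hf x hx ▸ hF.2 ⟨x, hx, rfl⟩
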